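/- Let $K$ be a field, $S=K[x_1,\dots,x_n]$ with the standard grading, and let $I\subset S$ be a graded ideal such that $S/I$ is Cohen–Macaulay, with $p=\operatorname{projdim}_S(S/I)$ (in particular $I\neq S$). For a finitely generated graded $S$-module $N$ let $\beta_{i,j}(N)$ be the number of basis elements of degree $j$ in the $i$-th module of the minimal graded free resolution of $N$ over $S$, let $\beta_i(N)=\sum_{j\in\mathbb Z}\beta_{i,j}(N)$, and let $M_i(N)=\max\{j\in\mathbb Z:\beta_{i,j}(N)\neq 0\}$. A graded ideal $J$ has a $1$-linear resolution if $\beta_{i,i+j}(J)=0$ for all $i\ge 0$ and all $j\neq 1$. Let $f\in S$ be homogeneous of degree $d>0$ and a non-zero-divisor on $S/I$. Assume that $$\beta_i(S/I)\le \frac{1}{(i-1)!\,(p-i)!}\prod_{1\le j\le p,\ j\ne i}M_j(S/I)\qquad\text{for all } 1\le i\le p.$$ Then $$\beta_i(S/(I,f))\le \frac{1}{(i-1)!\,(p+1-i)!}\prod_{1\le j\le p+1,\ j\ne i}M_j(S/(I,f))\qquad\text{for all } 1\le i\le p+1.$$ Moreover, if $p\ge 1$ (that is, $I\neq 0$), then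 equality holds in the last inequality for all $1\le i\le p+1$ if and only if $d=1$ and both $I$ and $(I,f)$ have $1$-linear resolutions. -/

import Mathlib

attribute [local instance] MvPolynomial.gradedAlgebra

namespace BettiBounds

open MvPolynomial

/-! ### Cohen–Macaulay rings -/

/-- A local ring `R` is Cohen–Macaulay if some `R`-regular sequence has length `dim R`
(in a Noetherian local ring no regular sequence is longer, so this says `depth R = dim R`). -/
def IsCohenMacaulayLocal (R : Type*) [CommRing R] : Prop :=
  ∃ rs : List R, RingTheory.Sequence.IsRegular R rs ∧
    (rs.length : WithBot ℕ∞) = ringKrullDim R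

/-- A Noetherian ring is Cohen–Macaulay if all its localizations at maximal ideals are. -/
structure IsCohenMacaulay (R : Type*) [CommRing R] : Prop where
  noetherian : IsNoetherianRing R
  localization : ∀ (m : Ideal R) [m.IsMaximal], IsCohenMacaulayLocal (Localization.AtPrime m)

/-! ### Gradings

A `ℤ`-grading of a module `M` over `S = K[x₁, …, xₙ]` is recorded by the subgroups `ℳ j ⊆ M` of
homogeneous elements of degree `j`. -/

/-- The component `S_j` of `S = K[x₁, …, xₙ]`, standard grading; it is `0` for `j < 0`. -/
def polyDeg (K : Type*) [Field K] (n : ℕ) (j : ℤ) : AddSubgroup (MvPolynomial (Fin n) K) where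
  carrier := {g | ∀ m, g.coeff m ≠ 0 → (m.degree : ℤ) = j}
  zero_mem' := by simp
  add_mem' := by
    intro a b ha hb m hm
    by_cases h : a.coeff m = 0
    · exact hb m (by simpa [h] using hm)
    · exact ha m h
  neg_mem' := by
    intro a ha m hm
    exact ha m (by simpa using hm)

/-- The grading of a (homogeneous) ideal `I` of `S`: `I_j = I ∩ S_j`. -/
noncomputable def idealGrading {K : Type*} [Field K] {n : ℕ} (I : Ideal (MvPolynomial (Fin n) K)) (j : ℤ) :
    AddSubgroup I :=
  (polyDeg K n j).comap I.subtype.toAddMonoidHom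

/-- The grading of `S ⧸ I` for a (homogeneous) ideal `I`: `(S ⧸ I)_j` is the image of `S_j`. -/
noncomputable def quotientGrading {K : Type*} [Field K] {n : ℕ} (I : Ideal (MvPolynomial (Fin n) K)) (j : ℤ) :
    AddSubgroup (MvPolynomial (Fin n) K ⧸ I) :=
  (polyDeg K n j).map (Ideal.Quotient.mk I).toAddMonoidHom

/-! ### Minimal graded free resolutions and Betti numbers -/

/-- A minimal graded free resolution
`⋯ → F₂ → F₁ → F₀ → M → 0` of the graded module `(M, ℳ)` over `S = K[x₁, …, xₙ]`. Here
`F_i = ⨁_b S(-deg i b)` is free of finite rank with basis vectors `Pi.single b 1` of degree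
`deg i b`; all maps are homogeneous of degree `0`, the sequence is exact, and the matrices of
the differentials have entries in `(x₁, …, xₙ)`. -/
structure MinimalGradedFreeResolution (K : Type*) [Field K] (n : ℕ) {M : Type*}
    [AddCommGroup M] [Module (MvPolynomial (Fin n) K) M] (ℳ : ℤ → AddSubgroup M) where
  /-- the rank of `F_i` -/
  rank : ℕ → ℕ
  /-- the degrees of the basis vectors of `F_i` -/
  deg : ∀ i, Fin (rank i) → ℤ
  /-- the augmentation `F₀ → M` -/
  aug : (Fin (rank 0) → MvPolynomial (Fin n) K) →ₗ[MvPolynomial (Fin n) K] M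
  /-- the differential `F_{i+1} → F_i` -/
  d : ∀ i, (Fin (rank (i + 1)) → MvPolynomial (Fin n) K) →ₗ[MvPolynomial (Fin n) K]
    (Fin (rank i) → MvPolynomial (Fin n) K)
  aug_homogeneous : ∀ b, aug (Pi.single b 1) ∈ ℳ (deg 0 b)
  d_homogeneous : ∀ i b a,
    d i (Pi.single b 1) a ∈ polyDeg K n (deg (i + 1) b - deg i a)
  aug_surjective : Function.Surjective aug
  exact_zero : Function.Exact (d 0) aug
  exact_succ : ∀ i, Function.Exact (d (i + 1)) (d i)
  minimal : ∀ i b a, constantCoeff (d i (Pi.single b 1) a) = 0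

open Classical in
/-- The graded Betti number `β_{i,j}(M)`: the number of basis vectors of degree `j` in the
`i`-th module of a minimal graded free resolution of `M`. Any two minimal graded free
resolutions of `M` are isomorphic, so the one chosen does not matter. -/
noncomputable def gradedBetti (K : Type*) [Field K] (n : ℕ) {M : Type*}
    [AddCommGroup M] [Module (MvPolynomial (Fin n) K) M] (ℳ : ℤ → AddSubgroup M)
    (i : ℕ) (j : ℤ) : ℕ :=
  if h : Nonempty (MinimalGradedFreeResolution K n ℳ) then
    Fintype.card {b : Fin (h.some.rank i) // h.some.deg i b = j}
  else 0

/-- The total Betti number `β_i(M) = ∑_j β_{i,j}(M)`. -/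
noncomputable def totalBetti (K : Type*) [Field K] (n : ℕ) {M : Type*}
    [AddCommGroup M] [Module (MvPolynomial (Fin n) K) M] (ℳ : ℤ → AddSubgroup M) (i : ℕ) : ℕ :=
  ∑ᶠ j : ℤ, gradedBetti K n ℳ i j

/-- The maximal shift `M_i = max {j : β_{i,j}(M) ≠ 0}`. -/
noncomputable def maxShift (K : Type*) [Field K] (n : ℕ) {M : Type*}
    [AddCommGroup M] [Module (MvPolynomial (Fin n) K) M] (ℳ : ℤ → AddSubgroup M) (i : ℕ) : ℤ :=
  sSup {j : ℤ | gradedBetti K n ℳ i j ≠ 0}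

/-- The number `1 / ((i-1)! (q-i)!) * ∏_{1 ≤ j ≤ q, j ≠ i} M_j`, for `1 ≤ i ≤ q`. -/
noncomputable def shiftBound (K : Type*) [Field K] (n : ℕ) {M : Type*}
    [AddCommGroup M] [Module (MvPolynomial (Fin n) K) M] (ℳ : ℤ → AddSubgroup M)
    (q i : ℕ) : ℚ :=
  1 / (((i - 1).factorial : ℚ) * ((q - i).factorial : ℚ)) *
    ∏ j ∈ (Finset.Icc 1 q).erase i, (maxShift K n ℳ j : ℚ)

/-- The graded ideal `I` has a `k`-linear resolution: `β_{i,i+j}(I) = 0` for `j ≠ k`. -/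
def HasLinearResolution {K : Type*} [Field K] {n : ℕ} (k : ℤ)
    (I : Ideal (MvPolynomial (Fin n) K)) : Prop :=
  ∀ (i : ℕ) (j : ℤ), j ≠ k → gradedBetti K n (idealGrading I) i (i + j) = 0

/-! ### Existence of minimal graded free resolutions

The facts below only show that the choice in `gradedBetti` is from a nonempty type, for the graded
modules `I` and `S ⧸ I` of a homogeneous ideal `I`. -/

theorem mem_polyDeg {K : Type*} [Field K] {n : ℕ} {j : ℤ} {g : MvPolynomial (Fin n) K} :
    g ∈ polyDeg K n j ↔ ∀ m, g.coeff m ≠ 0 → (m.degree : ℤ) = j := Iff.rfl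

/-- the degree `j` component of a polynomial -/
noncomputable def polyComp (K : Type*) [Field K] (n : ℕ) (j : ℤ) :
    MvPolynomial (Fin n) K →ₗ[K] MvPolynomial (Fin n) K :=
  if 0 ≤ j then homogeneousComponent j.toNat else 0

theorem coeff_polyComp {K : Type*} [Field K] {n : ℕ} (j : ℤ) (g : MvPolynomial (Fin n) K)
    (m : Fin n →₀ ℕ) :
    (polyComp K n j g).coeff m = if (m.degree : ℤ) = j then g.coeff m else 0 := by
  unfold polyComp
  split_ifs with h h' h'
  · rw [coeff_homogeneousComponent, if_pos (by omega)]
  · rw [coeff_homogeneousComponent, if_neg (by omega)]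
  · omega
  · simp

/-- A grading by subgroups, given with the projections to its components. -/
structure GradedProj (K : Type*) [Field K] (n : ℕ) {M : Type*}
    [AddCommGroup M] [Module (MvPolynomial (Fin n) K) M] (ℳ : ℤ → AddSubgroup M) where
  π : ℤ → M →+ M
  mem : ∀ j v, π j v ∈ ℳ j
  same : ∀ j v, v ∈ ℳ j → π j v = v
  ne : ∀ j k v, v ∈ ℳ j → k ≠ j → π k v = 0
  sum : ∀ v, ∃ s : Finset ℤ, ∑ j ∈ s, π j v = v
  smul : ∀ i j g v, g ∈ polyDeg K n i → v ∈ ℳ j → g • v ∈ ℳ (i + j)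

theorem GradedProj.π_smul {K : Type*} [Field K] {n : ℕ} {M : Type*}
    [AddCommGroup M] [Module (MvPolynomial (Fin n) K) M] {ℳ : ℤ → AddSubgroup M}
    (P : GradedProj K n ℳ) (j i : ℤ) (r : MvPolynomial (Fin n) K) (v : M) (hv : v ∈ ℳ i) :
    P.π j (r • v) = polyComp K n (j - i) r • v := by
  induction r using MvPolynomial.induction_on' with
  | monomial m a =>
    have hm : monomial m a ∈ polyDeg K n m.degree := by
      intro m' h'
      rw [coeff_monomial] at h'
      split_ifs at h' with h
      · rw [h]
      · exact absurd rfl h'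
    have hmem := P.smul _ _ _ _ hm hv
    by_cases h : (m.degree : ℤ) + i = j
    · have : polyComp K n (j - i) (monomial m a) = monomial m a := by
        ext m'
        rw [coeff_polyComp]
        split_ifs with h1
        · rfl
        · rw [coeff_monomial, if_neg]
          rintro rfl
          omega
      rw [this, P.same]
      rwa [← h]
    · have : polyComp K n (j - i) (monomial m a) = 0 := by
        ext m'
        rw [coeff_polyComp]
        split_ifs with h1
        · rw [coeff_monomial, if_neg]
          · simp
          rintro rfl
          omega
        · simp
      rw [this, zero_smul, P.ne _ _ _ hmem (Ne.symm h)]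
  | add p q hp hq => rw [add_smul, map_add, hp, hq, map_add, add_smul]

/-- the grading of `⨁_b S(-deg b)` -/
noncomputable def freeGrading (K : Type*) [Field K] (n : ℕ) {k : ℕ} (deg : Fin k → ℤ) (j : ℤ) :
    AddSubgroup (Fin k → MvPolynomial (Fin n) K) :=
  AddSubgroup.pi Set.univ fun b => polyDeg K n (j - deg b)

noncomputable def freeProj (K : Type*) [Field K] (n : ℕ) {k : ℕ} (deg : Fin k → ℤ) :
    GradedProj K n (freeGrading K n deg) where
  π j :=
    { toFun := fun v b => polyComp K n (j - deg b) (v b)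
      map_zero' := by ext; simp
      map_add' := by intro v w; ext; simp }
  mem j v b _ m hm := by
    simp only [AddMonoidHom.coe_mk, ZeroHom.coe_mk, coeff_polyComp] at hm
    by_contra h
    exact hm (if_neg h)
  same j v hv := by
    funext b
    ext m
    simp only [AddMonoidHom.coe_mk, ZeroHom.coe_mk, coeff_polyComp]
    split_ifs with h
    · rfl
    · by_contra h'
      exact h (hv b (Set.mem_univ _) m (Ne.symm h'))
  ne j k v hv hkj := by
    funext b
    ext m
    simp only [AddMonoidHom.coe_mk, ZeroHom.coe_mk, coeff_polyComp, Pi.zero_apply, coeff_zero]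
    split_ifs with h
    · by_contra h'
      have := hv b (Set.mem_univ _) m h'
      omega
    · rfl
  sum v := by
    classical
    refine ⟨Finset.univ.biUnion fun b => (v b).support.image fun m => (m.degree : ℤ) + deg b, ?_⟩
    funext b
    ext m
    simp only [Finset.sum_apply, AddMonoidHom.coe_mk, ZeroHom.coe_mk, coeff_sum, coeff_polyComp]
    by_cases h : (v b).coeff m = 0
    · simp [h]
    · rw [Finset.sum_eq_single ((m.degree : ℤ) + deg b)]
      · simp
      · intro j _ hj
        rw [if_neg]
        omega
      · intro hn
        refine absurd ?_ hn
        simp only [Finset.mem_biUnion, Finset.mem_univ, true_and, Finset.mem_image]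
        exact ⟨b, m, by simpa using h, rfl⟩
  smul i j g v hg hv b _ m hm := by
    classical
    simp only [Pi.smul_apply, smul_eq_mul, coeff_mul] at hm
    obtain ⟨⟨x, y⟩, hx, hne⟩ := Finset.exists_ne_zero_of_sum_ne_zero hm
    have h1 := hg x (left_ne_zero_of_mul hne)
    have h2 := hv b (Set.mem_univ _) y (right_ne_zero_of_mul hne)
    rw [Finset.HasAntidiagonal.mem_antidiagonal] at hx
    simp only at hx
    rw [← hx, map_add]
    push_cast
    omega

/-- a submodule that is stable under the projections is graded -/
noncomputable def GradedProj.restrict {K : Type*} [Field K] {n : ℕ} {M : Type*}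
    [AddCommGroup M] [Module (MvPolynomial (Fin n) K) M] {ℳ : ℤ → AddSubgroup M}
    (P : GradedProj K n ℳ) (N : Submodule (MvPolynomial (Fin n) K) M)
    (hN : ∀ j, ∀ v ∈ N, P.π j v ∈ N) :
    GradedProj K n (fun j => (ℳ j).comap N.subtype.toAddMonoidHom) where
  π j :=
    { toFun := fun v => ⟨P.π j v, hN j v v.2⟩
      map_zero' := by ext; simp
      map_add' := by intro v w; ext; simp }
  mem j v := P.mem j v
  same j v hv := Subtype.ext (P.same j v hv)
  ne j k v hv hk := Subtype.ext (P.ne j k v hv hk)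
  sum v := by
    obtain ⟨s, hs⟩ := P.sum v
    exact ⟨s, Subtype.ext (by simpa using hs)⟩
  smul i j g v hg hv := P.smul i j g v hg hv

/-- a finite graded module has a minimal system of homogeneous generators -/
theorem GradedProj.exists_cover {K : Type*} [Field K] {n : ℕ} {M : Type*}
    [AddCommGroup M] [Module (MvPolynomial (Fin n) K) M] {ℳ : ℤ → AddSubgroup M}
    (P : GradedProj K n ℳ) [Module.Finite (MvPolynomial (Fin n) K) M] :
    ∃ (k : ℕ) (deg : Fin k → ℤ)
      (φ : (Fin k → MvPolynomial (Fin n) K) →ₗ[MvPolynomial (Fin n) K] M),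
      (∀ b, φ (Pi.single b 1) ∈ ℳ (deg b)) ∧ Function.Surjective φ ∧
      (∀ v, φ v = 0 → ∀ b, constantCoeff (v b) = 0) ∧
      (∀ j v, φ v = 0 → φ ((freeProj K n deg).π j v) = 0) := by
  classical
  have hex : ∃ k : ℕ, ∃ g : Fin k → M, (∀ b, ∃ j, g b ∈ ℳ j) ∧
      Submodule.span (MvPolynomial (Fin n) K) (Set.range g) = ⊤ := by
    have htop : Submodule.span (MvPolynomial (Fin n) K) {v : M | ∃ j, v ∈ ℳ j} = ⊤ := by
      rw [eq_top_iff]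
      intro v _
      obtain ⟨s, hs⟩ := P.sum v
      rw [← hs]
      exact Submodule.sum_mem _ fun j _ => Submodule.subset_span ⟨j, P.mem j v⟩
    have hfg : (Submodule.span (MvPolynomial (Fin n) K) {v : M | ∃ j, v ∈ ℳ j}).FG := by
      rw [htop]; exact Module.Finite.fg_top
    obtain ⟨t, ht, hst⟩ := (Submodule.fg_span_iff_fg_span_finset_subset _).1 hfg
    refine ⟨t.card, fun b => (t.equivFin.symm b : M), fun b => ht (t.equivFin.symm b).2, ?_⟩
    rw [← htop, hst]
    congr 1
    ext v
    constructor
    · rintro ⟨b, rfl⟩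
      exact (t.equivFin.symm b).2
    · intro hv
      exact ⟨t.equivFin ⟨v, hv⟩, by simp⟩
  obtain ⟨g, hg, hspan⟩ := Nat.find_spec hex
  have hmin := fun k (hk : k < Nat.find hex) => Nat.find_min hex hk
  generalize Nat.find hex = k at g hg hspan hmin
  choose deg hdeg using hg
  have hφ : ∀ v : Fin k → MvPolynomial (Fin n) K,
      Fintype.linearCombination (MvPolynomial (Fin n) K) g v = ∑ b, v b • g b := fun v =>
    Fintype.linearCombination_apply _ _ _
  have hπ : ∀ j (v : Fin k → MvPolynomial (Fin n) K),
      ∑ b, polyComp K n (j - deg b) (v b) • g b = P.π j (∑ b, v b • g b) := by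
    intro j v
    rw [map_sum]
    exact Finset.sum_congr rfl fun b _ => (P.π_smul j (deg b) (v b) (g b) (hdeg b)).symm
  refine ⟨k, deg, Fintype.linearCombination (MvPolynomial (Fin n) K) g, ?_, ?_, ?_, ?_⟩
  · intro b
    rw [Fintype.linearCombination_apply_single, one_smul]
    exact hdeg b
  · rw [← LinearMap.range_eq_top, Fintype.range_linearCombination, hspan]
  · intro v hv c
    by_contra hc
    rw [hφ] at hv
    have h1 := hπ (deg c) v
    rw [hv, map_zero] at h1
    obtain _ | k := k
    · exact c.elim0
    refine hmin k (Nat.lt_succ_self k) ⟨g ∘ c.succAbove, fun b => ⟨_, hdeg _⟩, ?_⟩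
    have hcc : polyComp K n (deg c - deg c) (v c) = C (constantCoeff (v c)) := by
      ext m
      rw [coeff_polyComp, coeff_C, sub_self]
      by_cases hm : m = 0
      · subst hm; simp [constantCoeff_eq]
      · rw [if_neg (by simpa [Finsupp.degree_eq_zero_iff] using hm), if_neg (Ne.symm hm)]
    rw [Fin.sum_univ_succAbove _ c, hcc] at h1
    have h2 : g c = (C (constantCoeff (v c))⁻¹ : MvPolynomial (Fin n) K) •
        ((C (constantCoeff (v c)) : MvPolynomial (Fin n) K) • g c) := by
      rw [smul_smul, ← C_mul, inv_mul_cancel₀ hc, C_1, one_smul]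
    have h3 : g c ∈ Submodule.span (MvPolynomial (Fin n) K) (Set.range (g ∘ c.succAbove)) := by
      rw [h2, eq_neg_of_add_eq_zero_left h1]
      refine Submodule.smul_mem _ _ (Submodule.neg_mem _ (Submodule.sum_mem _ fun b _ => ?_))
      exact Submodule.smul_mem _ _ (Submodule.subset_span ⟨b, rfl⟩)
    rw [eq_top_iff, ← hspan, Submodule.span_le]
    rintro _ ⟨b, rfl⟩
    rcases eq_or_ne b c with rfl | hb
    · exact h3
    · obtain ⟨b', rfl⟩ := Fin.exists_succAbove_eq hb
      exact Submodule.subset_span ⟨b', rfl⟩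
  · intro j v hv
    rw [hφ] at hv ⊢
    exact (hπ j v).trans (by rw [hv, map_zero])

/-- a graded submodule of `⨁_b S(-deg b)` inside `(x₁, …, xₙ) ⨁_b S(-deg b)` -/
structure SyzygyStage (K : Type*) [Field K] (n : ℕ) where
  k : ℕ
  deg : Fin k → ℤ
  N : Submodule (MvPolynomial (Fin n) K) (Fin k → MvPolynomial (Fin n) K)
  min : ∀ v ∈ N, ∀ b, constantCoeff (v b) = 0
  graded : ∀ j, ∀ v ∈ N, (freeProj K n deg).π j v ∈ N

theorem SyzygyStage.exists_next {K : Type*} [Field K] {n : ℕ} (A : SyzygyStage K n) :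
    ∃ (B : SyzygyStage K n)
      (φ : (Fin B.k → MvPolynomial (Fin n) K) →ₗ[MvPolynomial (Fin n) K]
        (Fin A.k → MvPolynomial (Fin n) K)),
      (∀ b a, φ (Pi.single b 1) a ∈ polyDeg K n (B.deg b - A.deg a)) ∧
      LinearMap.range φ = A.N ∧ LinearMap.ker φ = B.N := by
  obtain ⟨k, deg, φ, h1, h2, h3, h4⟩ := ((freeProj K n A.deg).restrict A.N A.graded).exists_cover
  refine ⟨⟨k, deg, LinearMap.ker φ, fun v hv => h3 v hv, fun j v hv => h4 j v hv⟩,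
    A.N.subtype ∘ₗ φ, fun b a => h1 b a (Set.mem_univ _), ?_, ?_⟩
  · rw [LinearMap.range_comp, LinearMap.range_eq_top.2 h2, Submodule.map_top,
      Submodule.range_subtype]
  · rw [LinearMap.ker_comp, Submodule.ker_subtype]
    rfl

/-- Every finitely generated graded module has a minimal graded free resolution. -/
theorem GradedProj.nonempty_resolution {K : Type*} [Field K] {n : ℕ} {M : Type*}
    [AddCommGroup M] [Module (MvPolynomial (Fin n) K) M] {ℳ : ℤ → AddSubgroup M}
    (P : GradedProj K n ℳ) [Module.Finite (MvPolynomial (Fin n) K) M] :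
    Nonempty (MinimalGradedFreeResolution K n ℳ) := by
  obtain ⟨k, deg, aug, h1, h2, h3, h4⟩ := P.exists_cover
  choose next φ hφ hr hk using SyzygyStage.exists_next (K := K) (n := n)
  let st : ℕ → SyzygyStage K n := fun i =>
    Nat.rec ⟨k, deg, LinearMap.ker aug, fun v hv => h3 v hv, fun j v hv => h4 j v hv⟩
      (fun _ A => next A) i
  refine ⟨⟨fun i => (st i).k, fun i => (st i).deg, aug, fun i => φ (st i), h1,
    fun i b a => hφ (st i) b a, h2, ?_, ?_, ?_⟩⟩
  · rw [LinearMap.exact_iff]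
    exact (hr (st 0)).symm
  · intro i
    rw [LinearMap.exact_iff]
    exact (hk (st i)).trans (hr (st (i + 1))).symm
  · intro i b a
    refine (st i).min _ ?_ a
    rw [← hr (st i)]
    exact ⟨_, rfl⟩

/-- the standard grading of `S` -/
noncomputable def selfProj (K : Type*) [Field K] (n : ℕ) : GradedProj K n (polyDeg K n) where
  π j := (polyComp K n j).toAddMonoidHom
  mem j v := by
    simpa [freeProj] using (freeProj K n (fun _ : Fin 1 => 0)).mem j (fun _ => v) 0 trivial
  same j v hv := by
    have := (freeProj K n (fun _ : Fin 1 => 0)).same j (fun _ => v) (fun _ _ => by simpa using hv)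
    simpa [freeProj] using congrFun this 0
  ne j k v hv hk := by
    have := (freeProj K n (fun _ : Fin 1 => 0)).ne j k (fun _ => v)
      (fun _ _ => by simpa using hv) hk
    simpa [freeProj] using congrFun this 0
  sum v := by
    obtain ⟨s, hs⟩ := (freeProj K n (fun _ : Fin 1 => 0)).sum (fun _ => v)
    exact ⟨s, by simpa [freeProj] using congrFun hs 0⟩
  smul i j g v hg hv := by
    simpa using (freeProj K n (fun _ : Fin 1 => 0)).smul i j g (fun _ => v) hg
      (fun _ _ => by simpa using hv) 0 trivial

theorem polyComp_mem {K : Type*} [Field K] {n : ℕ} {I : Ideal (MvPolynomial (Fin n) K)}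
    (hI : I.IsHomogeneous (homogeneousSubmodule (Fin n) K)) (j : ℤ) (v : MvPolynomial (Fin n) K)
    (hv : v ∈ I) : polyComp K n j v ∈ I := by
  unfold polyComp
  split_ifs
  · exact homogeneousComponent_mem_of_mem hI hv _
  · exact I.zero_mem

theorem nonempty_resolution_ideal {K : Type*} [Field K] {n : ℕ}
    {I : Ideal (MvPolynomial (Fin n) K)}
    (hI : I.IsHomogeneous (homogeneousSubmodule (Fin n) K)) :
    Nonempty (MinimalGradedFreeResolution K n (idealGrading I)) :=
  ((selfProj K n).restrict I (polyComp_mem hI)).nonempty_resolution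

theorem nonempty_resolution_quotient {K : Type*} [Field K] {n : ℕ}
    {I : Ideal (MvPolynomial (Fin n) K)}
    (hI : I.IsHomogeneous (homogeneousSubmodule (Fin n) K)) :
    Nonempty (MinimalGradedFreeResolution K n (quotientGrading I)) := by
  let π : ℤ → (MvPolynomial (Fin n) K ⧸ I) →+ (MvPolynomial (Fin n) K ⧸ I) := fun j =>
    (Submodule.mapQ (I.restrictScalars K) (I.restrictScalars K) (polyComp K n j)
      (fun v hv => polyComp_mem hI j v hv)).toAddMonoidHom
  have hπ : ∀ j v, π j (Ideal.Quotient.mk I v) = Ideal.Quotient.mk I (polyComp K n j v) :=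
    fun j v => rfl
  have P : GradedProj K n (quotientGrading I) :=
    { π := π
      mem := by
        intro j v
        obtain ⟨v, rfl⟩ := Ideal.Quotient.mk_surjective v
        exact ⟨_, (selfProj K n).mem j v, rfl⟩
      same := by
        rintro j _ ⟨v, hv, rfl⟩
        exact congrArg (Ideal.Quotient.mk I) ((selfProj K n).same j v hv)
      ne := by
        rintro j k _ ⟨v, hv, rfl⟩ hk
        refine (congrArg (Ideal.Quotient.mk I) ((selfProj K n).ne j k v hv hk)).trans ?_
        exact map_zero _
      sum := by
        intro v
        obtain ⟨v, rfl⟩ := Ideal.Quotient.mk_surjective v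
        obtain ⟨s, hs⟩ := (selfProj K n).sum v
        refine ⟨s, ?_⟩
        conv_rhs => rw [← hs, map_sum]
        rfl
      smul := by
        rintro i j g _ hg ⟨v, hv, rfl⟩
        exact ⟨g * v, (selfProj K n).smul i j g v hg hv, rfl⟩ }
  exact P.nonempty_resolution

end BettiBounds

/-!
Write `β_i`, `M_i` for the Betti numbers and maximal shifts of `S ⧸ I`, and `β'_i`, `M'_i` for those
of `S ⧸ (I, f)`.

The mapping cone of multiplication by `f` on the minimal graded free resolution of `S ⧸ I` is a
graded free resolution of `S ⧸ (I, f)`, and it is minimal as `f` has positive degree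
(`exists_resolution_sup_span`). Any minimal graded free resolution computes the graded Betti numbers
(`gradedBetti_eq`), so `β'_{i+1} = β_{i+1} + β_i` and `M'_{i+1} ≥ max (M_{i+1}, M_i + d)`.

Cohen–Macaulayness enters through `M_0 < M_1 < ⋯ < M_p`. If a basis vector in homological degree
`j < p` has degree at least that of all basis vectors in homological degree `j + 1`, then, by
minimality, its coordinate function is a cocycle of `Hom(C, S)`, where `C` is the minimal resolution
(`exists_deg_lt`). As `Ext^j(S ⧸ I, S)` vanishes at the origin for `j < p`, this cocycle becomes a
coboundary there, and so it has values in `(x₁, …, xₙ)`, but one of its values is `1`. The vanishing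
of `Ext` and the bound on the length of `C` that goes with it are in
`FreeResolution.isEmpty_and_isCoboundary_of_isWeaklyRegular`: dividing by a maximal regular sequence
of the local ring reduces both, through mapping cones and Nakayama's lemma, to a module on which
the variables act nilpotently. For such a module the variables, a regular sequence on the
polynomial ring, give `Ext^j = 0` for `j < n`, and Hilbert's syzygy theorem gives the length `n`.

For `i ≤ p`, with `Q = ∏_{j ≤ p, j ≠ i} M_j`, the assumed bounds give
`(i - 1)! (p + 1 - i)! β'_i ≤ (p + 1 - i) Q + M_i Q`, and
`p + 1 - i + M_i ≤ M_p + 1 ≤ M'_{p+1}` gives the claim (`cone_bound`). Equality for `i = p + 1` forces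
`M_p = p` and `d = 1` (`eq_of_cone_bound_eq`); then all shifts are the smallest possible ones and the
resolutions are linear. Conversely, an ideal with a `1`-linear resolution is generated by linearly
independent linear forms, and the Koszul resolution (`exists_resolution_linearForms`) has Betti
numbers `(p + 1).choose i` and shifts `i`, for which equality holds.
-/

namespace BettiBounds

open MvPolynomial

/-! ### Free resolutions over a commutative ring -/

/-- A resolution `⋯ → C₂ → C₁ → C₀ → N → 0` of the `R`-module `N` by finite free modules
`C_i = R^(ι i)`. The index types `ι i` are arbitrary finite types, so that mapping cones can be
formed without renumbering bases. -/
structure FreeResolution (R : Type*) [CommRing R] (N : Type*) [AddCommGroup N] [Module R N] where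
  /-- the index type of the basis of `C_i` -/
  ι : ℕ → Type
  finite : ∀ i, Finite (ι i)
  /-- the augmentation `C₀ → N` -/
  aug : (ι 0 → R) →ₗ[R] N
  /-- the differential `C_{i+1} → C_i` -/
  d : ∀ i, (ι (i + 1) → R) →ₗ[R] (ι i → R)
  aug_surjective : Function.Surjective aug
  exact_zero : Function.Exact (d 0) aug
  exact_succ : ∀ i, Function.Exact (d (i + 1)) (d i)

attribute [instance] FreeResolution.finite

section Lift

variable {R : Type*} [CommRing R] {ι : Type*} [Finite ι] {P Q : Type*} [AddCommGroup P]
  [Module R P] [AddCommGroup Q] [Module R Q]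

theorem exists_comp_eq (g : P →ₗ[R] Q) (φ : (ι → R) →ₗ[R] Q) (h : ∀ v, ∃ w, g w = φ v) :
    ∃ ψ : (ι → R) →ₗ[R] P, φ = g ∘ₗ ψ := by
  choose w hw using h
  refine ⟨(Pi.basisFun R ι).constr R fun b => w (Pi.basisFun R ι b), ?_⟩
  refine (Pi.basisFun R ι).ext fun b => ?_
  rw [LinearMap.comp_apply, Module.Basis.constr_basis, hw]

theorem apply_eq_sum [Fintype ι] [DecidableEq ι] (φ : (ι → R) →ₗ[R] Q) (v : ι → R) :
    φ v = ∑ b, v b • φ (Pi.single b 1) := by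
  conv_lhs => rw [← (Pi.basisFun R ι).sum_repr v]
  simp

/-- A linear map from a free module maps vectors with entries in `𝔪` to vectors with entries
in `𝔪`. -/
theorem apply_mem_of_forall_mem {κ : Type*} {𝔪 : Ideal R} (φ : (ι → R) →ₗ[R] (κ → R))
    {v : ι → R} (hv : ∀ b, v b ∈ 𝔪) (a : κ) : φ v a ∈ 𝔪 := by
  classical
  have := Fintype.ofFinite ι
  rw [apply_eq_sum φ v, Finset.sum_apply]
  exact Ideal.sum_mem _ fun b _ => 𝔪.mul_mem_right _ (hv b)

end Lift

namespace FreeResolution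

variable {R : Type*} [CommRing R] {N : Type*} [AddCommGroup N] [Module R N]

/-- The entries of the matrices of the differentials lie in `𝔪`. -/
def IsMinimal (C : FreeResolution R N) (𝔪 : Ideal R) : Prop :=
  ∀ i v a, C.d i v a ∈ 𝔪

/-- `φ : C_j → Q` is a coboundary in the complex `Hom(C, Q)`, that is, it factors through the
differential out of `C_j`. For `j = 0` this says `φ = 0`. -/
def IsCoboundary (C : FreeResolution R N) {Q : Type*} [AddCommGroup Q] [Module R Q] :
    ∀ j, ((C.ι j → R) →ₗ[R] Q) → Prop
  | 0, φ => φ = 0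
  | j + 1, φ => ∃ ψ : (C.ι j → R) →ₗ[R] Q, φ = ψ ∘ₗ C.d j

section Coboundary

variable (C : FreeResolution R N) {Q Q' : Type*} [AddCommGroup Q] [Module R Q] [AddCommGroup Q']
  [Module R Q']

theorem d_comp_d (i : ℕ) : C.d i ∘ₗ C.d (i + 1) = 0 := by
  ext1 x
  exact (C.exact_succ i).linearMap_comp_eq_zero ▸ rfl

theorem d_d (i : ℕ) (v) : C.d i (C.d (i + 1) v) = 0 := LinearMap.congr_fun (C.d_comp_d i) v

theorem aug_d (v) : C.aug (C.d 0 v) = 0 :=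
  LinearMap.congr_fun C.exact_zero.linearMap_comp_eq_zero v

variable {C}

theorem IsCoboundary.comp {j : ℕ} {φ : (C.ι j → R) →ₗ[R] Q} (h : C.IsCoboundary j φ)
    (σ : Q →ₗ[R] Q') : C.IsCoboundary j (σ ∘ₗ φ) := by
  cases j with
  | zero => rw [show φ = 0 from h]; exact LinearMap.comp_zero _
  | succ j => obtain ⟨ψ, rfl⟩ := h; exact ⟨σ ∘ₗ ψ, rfl⟩

theorem IsCoboundary.add {j : ℕ} {φ ψ : (C.ι j → R) →ₗ[R] Q} (h : C.IsCoboundary j φ)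
    (h' : C.IsCoboundary j ψ) : C.IsCoboundary j (φ + ψ) := by
  cases j with
  | zero => rw [show φ = 0 from h, show ψ = 0 from h']; exact add_zero _
  | succ j => obtain ⟨φ, rfl⟩ := h; obtain ⟨ψ, rfl⟩ := h'; exact ⟨φ + ψ, rfl⟩

theorem isCoboundary_zero (j : ℕ) : C.IsCoboundary j (0 : (C.ι j → R) →ₗ[R] Q) := by
  cases j with
  | zero => rfl
  | succ j => exact ⟨0, rfl⟩

theorem IsCoboundary.smul {j : ℕ} {φ : (C.ι j → R) →ₗ[R] Q} (h : C.IsCoboundary j φ) (r : R) :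
    C.IsCoboundary j (r • φ) :=
  h.comp (r • LinearMap.id)

theorem IsCoboundary.comp_d {j : ℕ} {φ : (C.ι j → R) →ₗ[R] Q} (h : C.IsCoboundary j φ) :
    φ ∘ₗ C.d j = 0 := by
  cases j with
  | zero => rw [show φ = 0 from h]; exact LinearMap.zero_comp _
  | succ j => obtain ⟨ψ, rfl⟩ := h; rw [LinearMap.comp_assoc, d_comp_d, LinearMap.comp_zero]

theorem IsCoboundary.lift {j : ℕ} {φ : (C.ι j → R) →ₗ[R] Q'} (h : C.IsCoboundary j φ)
    (π : Q →ₗ[R] Q') (hπ : Function.Surjective π) :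
    ∃ ψ : (C.ι j → R) →ₗ[R] Q, C.IsCoboundary j ψ ∧ φ = π ∘ₗ ψ := by
  cases j with
  | zero => exact ⟨0, rfl, by rw [show φ = 0 from h, LinearMap.comp_zero]⟩
  | succ j =>
    obtain ⟨φ, rfl⟩ := h
    obtain ⟨ψ, rfl⟩ := exists_comp_eq π φ fun v => hπ _
    exact ⟨ψ ∘ₗ C.d j, ⟨ψ, rfl⟩, rfl⟩

theorem IsCoboundary.apply_mem {𝔪 : Ideal R} (hC : C.IsMinimal 𝔪) {κ : Type*} {j : ℕ}
    {φ : (C.ι j → R) →ₗ[R] (κ → R)} (h : C.IsCoboundary j φ) (v a) : φ v a ∈ 𝔪 := by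
  cases j with
  | zero => rw [show φ = 0 from h]; exact 𝔪.zero_mem
  | succ j =>
    obtain ⟨ψ, rfl⟩ := h
    exact apply_mem_of_forall_mem ψ (fun b => hC _ _ b) a

theorem IsCoboundary.exists_homotopy_zero {θ : (C.ι 0 → R) →ₗ[R] (C.ι 0 → R)}
    (hθ : C.aug ∘ₗ θ = 0) : ∃ s, C.IsCoboundary 0 (θ - C.d 0 ∘ₗ s) := by
  obtain ⟨s, hs⟩ := exists_comp_eq (C.d 0) θ fun v =>
    (C.exact_zero (θ v)).1 (LinearMap.congr_fun hθ v)
  exact ⟨s, sub_eq_zero.2 hs⟩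

/-- One step in the construction of a null-homotopy of an endomorphism of `C`: here `θ` and `θ'`
are its components in degrees `j` and `j + 1`, and `s` is the component of the homotopy in
degree `j`. -/
theorem IsCoboundary.exists_homotopy_succ {j : ℕ} {θ : (C.ι j → R) →ₗ[R] (C.ι j → R)}
    {s : (C.ι j → R) →ₗ[R] (C.ι (j + 1) → R)} (hs : C.IsCoboundary j (θ - C.d j ∘ₗ s))
    {θ' : (C.ι (j + 1) → R) →ₗ[R] (C.ι (j + 1) → R)} (hθ : C.d j ∘ₗ θ' = θ ∘ₗ C.d j) :
    ∃ s', C.IsCoboundary (j + 1) (θ' - C.d (j + 1) ∘ₗ s') := by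
  obtain ⟨s', hs'⟩ := exists_comp_eq (C.d (j + 1)) (θ' - s ∘ₗ C.d j) fun v =>
    (C.exact_succ j _).1 (by
      have h1 := LinearMap.congr_fun hs.comp_d v
      have h2 := LinearMap.congr_fun hθ v
      simp only [LinearMap.comp_apply, LinearMap.sub_apply, LinearMap.zero_apply] at h1 h2 ⊢
      rw [map_sub, h2, h1])
  exact ⟨s', s, by rw [← hs', sub_sub_cancel]⟩

/-- If `r` annihilates `N`, then multiplication by `r` on `C` is null-homotopic. -/
theorem exists_homotopy_smul {r : R} (hr : ∀ v : N, r • v = 0) (j : ℕ) :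
    ∃ s, C.IsCoboundary j (r • LinearMap.id - C.d j ∘ₗ s) := by
  induction j with
  | zero => exact IsCoboundary.exists_homotopy_zero (by ext1 v; simp [hr])
  | succ j ih =>
    obtain ⟨s, hs⟩ := ih
    exact hs.exists_homotopy_succ (by ext1 v; simp)

/-- The cohomology of `Hom(C, Q)` is annihilated by the annihilator of `N`. -/
theorem isCoboundary_smul_of_annihilates {r : R} (hr : ∀ v : N, r • v = 0) {j : ℕ}
    {φ : (C.ι j → R) →ₗ[R] Q} (hφ : φ ∘ₗ C.d j = 0) : C.IsCoboundary j (r • φ) := by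
  obtain ⟨s, hs⟩ := C.exists_homotopy_smul hr j
  convert hs.comp φ using 1
  rw [LinearMap.comp_sub, ← LinearMap.comp_assoc, hφ, LinearMap.zero_comp, sub_zero,
    LinearMap.comp_smul, LinearMap.comp_id]

end Coboundary

/-! ### Vanishing of `Ext` into a module with a regular sequence -/

section Vanishing

open RingTheory.Sequence Pointwise

theorem mkQ_quotSMulTop_eq_zero_iff {Q : Type*} [AddCommGroup Q] [Module R Q] {x : R} {q : Q} :
    (Submodule.mkQ (x • (⊤ : Submodule R Q))) q = 0 ↔ ∃ y, x • y = q := by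
  rw [Submodule.mkQ_apply, Submodule.Quotient.mk_eq_zero, Submodule.mem_smul_pointwise_iff_exists]
  simp

/-- If `x₁, …, x_l` is a regular sequence on `Q` and every `x_t` acts nilpotently on `N`, then
`Ext^j(N, Q) = 0` for `j < l`: by induction `x₁` acts injectively on the cohomology of `Hom(C, Q)`
in degree `j`, and a power of it acts as zero. -/
theorem isCoboundary_of_isWeaklyRegular (C : FreeResolution R N) (xs : List R) {Q : Type*}
    [AddCommGroup Q] [Module R Q] (hxs : IsWeaklyRegular Q xs)
    (hN : ∀ x ∈ xs, ∃ k : ℕ, ∀ v : N, x ^ k • v = 0) {j : ℕ} (hj : j < xs.length)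
    {φ : (C.ι j → R) →ₗ[R] Q} (hφ : φ ∘ₗ C.d j = 0) : C.IsCoboundary j φ := by
  induction xs generalizing Q j with
  | nil => simp at hj
  | cons x xs ih =>
    obtain ⟨hx, hxs⟩ := (isWeaklyRegular_cons_iff _ _ _).1 hxs
    have key : ∀ φ : (C.ι j → R) →ₗ[R] Q, C.IsCoboundary j (x • φ) → C.IsCoboundary j φ := by
      intro φ h
      cases j with
      | zero =>
        refine LinearMap.ext fun v => hx ?_
        simpa using LinearMap.congr_fun (show x • φ = 0 from h) v
      | succ j =>
        obtain ⟨ψ, hψ⟩ := h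
        let π := Submodule.mkQ (x • (⊤ : Submodule R Q))
        have h1 : C.IsCoboundary j (π ∘ₗ ψ) := by
          refine ih hxs (fun y hy => hN y (List.mem_cons_of_mem _ hy)) (by simpa using hj) ?_
          rw [LinearMap.comp_assoc, ← hψ]
          ext1 v
          exact mkQ_quotSMulTop_eq_zero_iff.2 ⟨φ v, rfl⟩
        obtain ⟨η, hη, hη'⟩ := h1.lift π (Submodule.mkQ_surjective _)
        obtain ⟨θ, hθ⟩ := exists_comp_eq (x • LinearMap.id) (ψ - η) fun v => by
          have : π ((ψ - η) v) = 0 := by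
            simpa [sub_eq_zero] using LinearMap.congr_fun hη' v
          exact mkQ_quotSMulTop_eq_zero_iff.1 this
        refine ⟨θ, LinearMap.ext fun v => hx ?_⟩
        have h2 := LinearMap.congr_fun hψ v
        have h3 := LinearMap.congr_fun hθ (C.d j v)
        have h4 := LinearMap.congr_fun hη.comp_d v
        simp only [LinearMap.comp_apply, LinearMap.sub_apply, LinearMap.smul_apply,
          LinearMap.id_apply, LinearMap.zero_apply] at h2 h3 h4 ⊢
        rw [h4, sub_zero] at h3
        exact h2.trans h3
    obtain ⟨k, hk⟩ := hN x List.mem_cons_self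
    have h := isCoboundary_smul_of_annihilates hk hφ
    clear hk
    induction k with
    | zero => simpa using h
    | succ k ihk => exact ihk (key _ (by rwa [smul_smul, ← pow_succ']))

end Vanishing

/-! ### Hilbert's syzygy theorem -/

section Syzygy

open RingTheory.Sequence Pointwise

open Classical in
/-- The differential of `C ⊗ Q`, where `C_i ⊗ Q` is written as `Q^(ι i)`. -/
noncomputable def tensorD (C : FreeResolution R N) (Q : Type*) [AddCommGroup Q] [Module R Q]
    (i : ℕ) : (C.ι (i + 1) → Q) →ₗ[R] (C.ι i → Q) :=
  letI := Fintype.ofFinite (C.ι (i + 1))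
  LinearMap.pi fun a => ∑ b, C.d i (Pi.single b 1) a • LinearMap.proj b

theorem tensorD_comp (C : FreeResolution R N) {Q Q' : Type*} [AddCommGroup Q] [Module R Q]
    [AddCommGroup Q'] [Module R Q'] (π : Q →ₗ[R] Q') (i : ℕ) (v : C.ι (i + 1) → Q) (a) :
    C.tensorD Q' i (fun b => π (v b)) a = π (C.tensorD Q i v a) := by
  simp [tensorD]

theorem tensorD_self (C : FreeResolution R N) (i : ℕ) : C.tensorD R i = C.d i := by
  classical
  let := Fintype.ofFinite (C.ι (i + 1))
  refine LinearMap.ext fun v => funext fun a => ?_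
  rw [apply_eq_sum (C.d i) v]
  simp only [tensorD, LinearMap.pi_apply, LinearMap.sum_apply, LinearMap.smul_apply,
    LinearMap.proj_apply, Finset.sum_apply, Pi.smul_apply, smul_eq_mul]
  refine Finset.sum_congr rfl fun b _ => ?_
  rw [mul_comm]

/-- If `C ⊗ Q` is exact in degrees above `j` and `xs` is a regular sequence on `Q` with
`𝔪 Q ⊆ (xs) Q`, then a minimal resolution `C` vanishes in degrees above `j + |xs|`: dividing `Q` by
one element of the sequence costs one degree of exactness, and at the end the differentials are
zero. -/
theorem isEmpty_of_tensorD_exact (C : FreeResolution R N) {𝔪 : Ideal R} (hC : C.IsMinimal 𝔪)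
    (xs : List R) {Q : Type*} [AddCommGroup Q] [Module R Q] (hxs : IsRegular Q xs)
    (h𝔪 : ∀ r ∈ 𝔪, ∀ q : Q, r • q ∈ Ideal.ofList xs • (⊤ : Submodule R Q)) (j : ℕ)
    (hj : ∀ i, j ≤ i → Function.Exact (C.tensorD Q (i + 1)) (C.tensorD Q i)) (i : ℕ)
    (hi : j + xs.length < i) : IsEmpty (C.ι i) := by
  induction xs generalizing Q j with
  | nil =>
    have h0 : ∀ i, C.tensorD Q i = 0 := by
      intro i
      ext1 v
      funext a
      simp only [tensorD, LinearMap.pi_apply, LinearMap.sum_apply, LinearMap.smul_apply,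
        LinearMap.proj_apply, LinearMap.zero_apply, Pi.zero_apply]
      refine Finset.sum_eq_zero fun b _ => ?_
      simpa using h𝔪 _ (hC i _ a) (v b)
    obtain _ | i := i
    · simp at hi
    by_contra hne
    rw [not_isEmpty_iff] at hne
    have := hxs.nontrivial
    obtain ⟨q, hq⟩ := exists_ne (0 : Q)
    obtain ⟨w, hw⟩ := (hj i (by simp at hi; omega) fun _ => q).1 (by rw [h0]; rfl)
    rw [h0] at hw
    exact hq (congrFun hw hne.some).symm
  | cons x xs ih =>
    obtain ⟨hx, hxs⟩ := (isRegular_cons_iff _ _ _).1 hxs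
    let π := Submodule.mkQ (x • (⊤ : Submodule R Q))
    have hπ : Function.Surjective π := Submodule.mkQ_surjective _
    refine ih hxs ?_ (j + 1) ?_ (by simp at hi; omega)
    · intro r hr q
      obtain ⟨q, rfl⟩ := hπ q
      rw [← map_smul]
      have h1 := h𝔪 r hr q
      rw [Ideal.ofList_cons_smul, Submodule.mem_sup] at h1
      obtain ⟨y, hy, z, hz, hyz⟩ := h1
      rw [← hyz, map_add, mkQ_quotSMulTop_eq_zero_iff.2
        (by simpa [Submodule.mem_smul_pointwise_iff_exists] using hy), zero_add]
      have h2 := Submodule.mem_map_of_mem (f := π) hz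
      rw [Submodule.map_smul''] at h2
      exact Submodule.smul_mono le_rfl le_top h2
    · intro i hi v
      obtain ⟨i, rfl⟩ : ∃ i', i = i' + 1 := ⟨i - 1, by omega⟩
      have hlift : ∀ {κ : Type} (v : κ → QuotSMulTop x Q), ∃ w : κ → Q, v = fun b => π (w b) :=
        fun v => ⟨fun b => (hπ (v b)).choose, funext fun b => (hπ (v b)).choose_spec.symm⟩
      constructor
      · intro hv
        obtain ⟨v, rfl⟩ := hlift v
        have h1 : ∀ a, ∃ y, x • y = C.tensorD Q (i + 1) v a := fun a =>
          mkQ_quotSMulTop_eq_zero_iff.1 ((C.tensorD_comp π (i + 1) v a).symm.trans (congrFun hv a))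
        choose w hw using h1
        have hw : x • w = C.tensorD Q (i + 1) v := funext hw
        have h2 : C.tensorD Q i w = 0 := by
          funext a
          refine hx ?_
          have := congrFun ((hj i (by omega) _).2 ⟨v, rfl⟩) a
          rw [← hw, map_smul] at this
          simpa using this
        obtain ⟨u, rfl⟩ := (hj i (by omega) w).1 h2
        obtain ⟨t, ht⟩ := (hj (i + 1) (by omega) (v - x • u)).1 (by
          rw [map_sub, map_smul, hw, sub_self])
        refine ⟨fun b => π (t b), funext fun a => ?_⟩
        rw [C.tensorD_comp, ht, Pi.sub_apply, map_sub, Pi.smul_apply,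
          mkQ_quotSMulTop_eq_zero_iff.2 ⟨u a, rfl⟩, sub_zero]
      · rintro ⟨w, rfl⟩
        obtain ⟨w, rfl⟩ := hlift w
        funext a
        have h1 : C.tensorD (QuotSMulTop x Q) (i + 1 + 1) (fun b => π (w b)) =
            fun a => π (C.tensorD Q (i + 1 + 1) w a) := funext (C.tensorD_comp π _ w)
        rw [h1, C.tensorD_comp, (hj (i + 1) (by omega) _).2 ⟨w, rfl⟩]
        exact map_zero π

/-- A minimal free resolution over a ring whose ideal `𝔪` is generated by a regular sequence `xs`
has length at most `|xs|`. -/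
theorem isEmpty_of_length_lt (C : FreeResolution R N) {𝔪 : Ideal R} (hC : C.IsMinimal 𝔪)
    {xs : List R} (hxs : IsRegular R xs) (h𝔪 : 𝔪 ≤ Ideal.ofList xs) {i : ℕ}
    (hi : xs.length < i) : IsEmpty (C.ι i) :=
  C.isEmpty_of_tensorD_exact hC xs hxs
    (fun r hr q => by
      rw [smul_eq_mul, smul_eq_mul, Ideal.mul_top]
      exact Ideal.mul_mem_right _ _ (h𝔪 hr)) 0
    (fun i _ => by rw [tensorD_self, tensorD_self]; exact C.exact_succ i) i (by omega)

end Syzygy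

/-! ### The mapping cone of a multiplication -/

section Cone

/-- the index types of the mapping cone of an endomorphism of a complex with index types `ι` -/
def ConeIndex (ι : ℕ → Type) : ℕ → Type
  | 0 => ι 0
  | i + 1 => ι (i + 1) ⊕ ι i

/-- The augmented mapping cone of multiplication by `f` on `C`, as a resolution of `N' = N / f N`,
for `f` regular on `N`; the quotient is given by a surjection `π : N → N'`. The differentials are
`(v, w) ↦ d v + f w` in degree `1` and `(v, w) ↦ (d v + f w, -d w)` above. -/
def cone (C : FreeResolution R N) {N' : Type*} [AddCommGroup N'] [Module R N'] {f : R}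
    (hf : IsSMulRegular N f) (π : N →ₗ[R] N') (hπ : Function.Surjective π)
    (hker : ∀ x, π x = 0 ↔ ∃ y, f • y = x) : FreeResolution R N' where
  ι := ConeIndex C.ι
  finite i := by
    cases i with
    | zero => exact C.finite 0
    | succ i => exact inferInstanceAs (Finite (C.ι (i + 1) ⊕ C.ι i))
  aug := π ∘ₗ C.aug
  d
    | 0 => C.d 0 ∘ₗ LinearMap.funLeft R R Sum.inl + f • LinearMap.funLeft R R Sum.inr
    | i + 1 => (LinearEquiv.sumArrowLequivProdArrow _ _ R R).symm.toLinearMap ∘ₗ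
        LinearMap.prod
          (C.d (i + 1) ∘ₗ LinearMap.funLeft R R Sum.inl + f • LinearMap.funLeft R R Sum.inr)
          (-(C.d i ∘ₗ LinearMap.funLeft R R Sum.inr))
  aug_surjective := hπ.comp C.aug_surjective
  exact_zero v := by
    change C.ι 0 → R at v
    constructor
    · intro hv
      obtain ⟨y, hy⟩ := (hker (C.aug v)).1 hv
      obtain ⟨y, rfl⟩ := C.aug_surjective y
      obtain ⟨w, hw⟩ := (C.exact_zero (v - f • y)).1 (by
        rw [map_sub, map_smul, sub_eq_zero]; exact hy.symm)
      exact ⟨Sum.elim w y, show C.d 0 w + f • y = v by rw [hw, sub_add_cancel]⟩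
    · rintro ⟨w, rfl⟩
      refine (hker _).2 ⟨C.aug fun b => w (Sum.inr b), ?_⟩
      change _ = C.aug (C.d 0 _ + f • _)
      rw [map_add, C.aug_d, zero_add, map_smul]
      rfl
  exact_succ i v := by
    set v₁ : C.ι (i + 1) → R := fun b => v (Sum.inl b)
    set v₂ : C.ι i → R := fun b => v (Sum.inr b)
    have hv : Sum.elim v₁ v₂ = v := by funext b; cases b <;> rfl
    have main : C.d i v₁ + f • v₂ = 0 → (∃ z, C.d i z = v₂) →
        ∃ (x : C.ι (i + 1 + 1) → R) (y : C.ι (i + 1) → R),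
          C.d (i + 1) x + f • y = v₁ ∧ -C.d i y = v₂ := by
      rintro h ⟨z, hz⟩
      obtain ⟨x, hx⟩ := (C.exact_succ i (v₁ + f • z)).1 (by rw [map_add, map_smul, hz, h])
      exact ⟨x, -z, by rw [hx, smul_neg, add_neg_cancel_right], by rw [map_neg, neg_neg, hz]⟩
    have range_of : (∃ (x : C.ι (i + 1 + 1) → R) (y : C.ι (i + 1) → R),
        C.d (i + 1) x + f • y = v₁ ∧ -C.d i y = v₂) → ∃ w : C.ι (i + 1 + 1) ⊕ C.ι (i + 1) → R,
          Sum.elim (C.d (i + 1) (fun b => w (Sum.inl b)) + f • fun b => w (Sum.inr b))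
            (-C.d i fun b => w (Sum.inr b)) = v := by
      rintro ⟨x, y, hx, hy⟩
      exact ⟨Sum.elim x y, by rw [← hv, ← hx, ← hy]; rfl⟩
    have of_range : ∀ w : C.ι (i + 1 + 1) ⊕ C.ι (i + 1) → R,
        Sum.elim (C.d (i + 1) (fun b => w (Sum.inl b)) + f • fun b => w (Sum.inr b))
          (-C.d i fun b => w (Sum.inr b)) = v →
        C.d i v₁ + f • v₂ = 0 ∧ ∃ z, C.d i z = v₂ := by
      intro w hw
      have h1 : v₁ = C.d (i + 1) (fun b => w (Sum.inl b)) + f • fun b => w (Sum.inr b) := by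
        funext b; exact (congrFun hw (Sum.inl b)).symm
      have h2 : v₂ = -C.d i fun b => w (Sum.inr b) := by
        funext b; exact (congrFun hw (Sum.inr b)).symm
      refine ⟨?_, -fun b => w (Sum.inr b), by rw [h2, map_neg]⟩
      rw [h1, h2, map_add, C.d_d, zero_add, map_smul, smul_neg, add_neg_cancel]
    cases i with
    | zero =>
      constructor
      · intro h
        change C.d 0 v₁ + f • v₂ = 0 at h
        refine range_of (main h ((C.exact_zero v₂).1 (hf ?_)))
        have := congrArg C.aug h
        rw [map_add, C.aug_d, zero_add, map_smul, map_zero] at this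
        simpa using this
      · rintro ⟨w, hw⟩
        exact (of_range w hw).1
    | succ i =>
      constructor
      · intro h
        have h1 : C.d (i + 1) v₁ + f • v₂ = 0 := funext fun b => congrFun h (Sum.inl b)
        have h2 : -C.d i v₂ = 0 := funext fun b => congrFun h (Sum.inr b)
        exact range_of (main h1 ((C.exact_succ i v₂).1 (by rwa [neg_eq_zero] at h2)))
      · rintro ⟨w, hw⟩
        obtain ⟨h1, z, hz⟩ := of_range w hw
        have h2 : -C.d i v₂ = 0 := by rw [← hz, C.d_d, neg_zero]
        funext b
        cases b with
        | inl b => exact congrFun h1 b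
        | inr b => exact congrFun h2 b

variable (C : FreeResolution R N) {N' : Type*} [AddCommGroup N'] [Module R N'] {f : R}
    (hf : IsSMulRegular N f) (π : N →ₗ[R] N') (hπ : Function.Surjective π)
    (hker : ∀ x, π x = 0 ↔ ∃ y, f • y = x)

theorem cone_isMinimal {𝔪 : Ideal R} (hC : C.IsMinimal 𝔪) (hf𝔪 : f ∈ 𝔪) :
    (C.cone hf π hπ hker).IsMinimal 𝔪 := by
  intro i v a
  cases i with
  | zero => exact 𝔪.add_mem (hC _ _ _) (𝔪.mul_mem_right _ hf𝔪)
  | succ i =>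
    cases a with
    | inl a => exact 𝔪.add_mem (hC _ _ _) (𝔪.mul_mem_right _ hf𝔪)
    | inr a => exact 𝔪.neg_mem (hC _ _ _)

/-- A piece of the long exact sequence of `Ext` for `0 → N → N → N / f N → 0`: if
`Ext^{j+1}(N / f N, R) = 0`, then `f` is surjective on `Ext^j(N, R)`. -/
theorem exists_isCoboundary_sub_smul {j : ℕ}
    (h : ∀ φ : ((C.cone hf π hπ hker).ι (j + 1) → R) →ₗ[R] R,
      φ ∘ₗ (C.cone hf π hπ hker).d (j + 1) = 0 → (C.cone hf π hπ hker).IsCoboundary (j + 1) φ)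
    {φ : (C.ι j → R) →ₗ[R] R} (hφ : φ ∘ₗ C.d j = 0) :
    ∃ ψ : (C.ι j → R) →ₗ[R] R, ψ ∘ₗ C.d j = 0 ∧ C.IsCoboundary j (φ - f • ψ) := by
  let φ' : (C.ι (j + 1) ⊕ C.ι j → R) →ₗ[R] R := φ ∘ₗ LinearMap.funLeft R R Sum.inr
  obtain ⟨ψ, hψ⟩ := h φ' (by
    ext1 v
    change φ (-C.d j _) = 0
    rw [map_neg, neg_eq_zero]
    exact LinearMap.congr_fun hφ _)
  have h1 : ∀ (x : C.ι (j + 1) → R) (y : C.ι j → R),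
      φ y = ψ ((C.cone hf π hπ hker).d j (Sum.elim x y)) := fun x y =>
    LinearMap.congr_fun hψ (Sum.elim x y)
  cases j with
  | zero =>
    change (C.ι 0 → R) →ₗ[R] R at ψ
    change ∀ (x : C.ι 1 → R) (y : C.ι 0 → R), φ y = ψ (C.d 0 x + f • y) at h1
    refine ⟨ψ, LinearMap.ext fun x => ?_, LinearMap.ext fun y => ?_⟩
    · have := h1 x 0
      rw [smul_zero, add_zero, map_zero] at this
      exact this.symm
    · have := h1 0 y
      rw [map_zero, zero_add, map_smul] at this
      exact sub_eq_zero.2 this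
  | succ j =>
    let e := (LinearEquiv.sumArrowLequivProdArrow (C.ι (j + 1)) (C.ι j) R R).symm.toLinearMap
    let ψ' : ((C.ι (j + 1) ⊕ C.ι j) → R) →ₗ[R] R := ψ
    let ψ₁ := ψ' ∘ₗ e ∘ₗ LinearMap.inl R _ _
    let ψ₂ := ψ' ∘ₗ e ∘ₗ LinearMap.inr R _ _
    have hsplit : ∀ x y, ψ' (e (x, y)) = ψ₁ x + ψ₂ y := fun x y => by
      simp only [ψ₁, ψ₂, LinearMap.comp_apply, LinearMap.inl_apply, LinearMap.inr_apply]
      rw [← map_add, ← map_add, Prod.mk_add_mk, add_zero, zero_add]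
    have h2 : ∀ (x : C.ι (j + 1 + 1) → R) (y : C.ι (j + 1) → R),
        φ y = ψ₁ (C.d (j + 1) x + f • y) + ψ₂ (-C.d j y) := fun x y =>
      (h1 x y).trans (hsplit _ _)
    refine ⟨ψ₁, LinearMap.ext fun x => ?_, -ψ₂, LinearMap.ext fun y => ?_⟩
    · have := h2 x 0
      rw [smul_zero, add_zero, map_zero, map_zero, neg_zero, map_zero, add_zero] at this
      exact this.symm
    · have := h2 0 y
      rw [map_zero, zero_add, map_smul, map_neg] at this
      simp [this]

end Cone

end FreeResolution

namespace FreeResolution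

/-! ### Resolutions over a local ring whose maximal ideal is generated by a regular sequence -/

section Local

open RingTheory.Sequence Pointwise

variable {R : Type*} [CommRing R] {N : Type*} [AddCommGroup N] [Module R N]

/-- The coboundaries in degree `j` of `Hom(C, R)`. -/
def coboundaries (C : FreeResolution R N) (j : ℕ) : Submodule R ((C.ι j → R) →ₗ[R] R) where
  carrier := {φ | C.IsCoboundary j φ}
  add_mem' := IsCoboundary.add
  zero_mem' := isCoboundary_zero j
  smul_mem' r _ h := h.smul r

/-- Let `𝔪` be generated by a regular sequence `xs` of length `n` and contained in the Jacobson
radical of `R`, and let `ys` in `𝔪` be a regular sequence of length `e` on `N` such that `xs` acts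
nilpotently on `N / (ys) N`. Then a minimal free resolution of `N` has length at most `n - e`, and
`Ext^j(N, R) = 0` for `j < n - e`. The case `e = 0` is given by `isEmpty_of_length_lt` and
`isCoboundary_of_isWeaklyRegular`, and one passes from `N` to `N / y N` by the mapping cone and
Nakayama's lemma. -/
theorem isEmpty_and_isCoboundary_of_isWeaklyRegular [IsNoetherianRing R] {𝔪 : Ideal R}
    (hjac : 𝔪 ≤ Ideal.jacobson ⊥) {xs : List R} (hxs : IsRegular R xs)
    (h𝔪 : Ideal.ofList xs = 𝔪) (C : FreeResolution R N) (hC : C.IsMinimal 𝔪) (ys : List R)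
    (hys : IsWeaklyRegular N ys) (hys𝔪 : ∀ y ∈ ys, y ∈ 𝔪)
    (hnil : ∀ x ∈ xs, ∃ k : ℕ, ∀ v : N, x ^ k • v ∈ Ideal.ofList ys • (⊤ : Submodule R N)) :
    (∀ i, xs.length < i + ys.length → IsEmpty (C.ι i)) ∧
    ∀ j, j + ys.length < xs.length → ∀ φ : (C.ι j → R) →ₗ[R] R, φ ∘ₗ C.d j = 0 →
      C.IsCoboundary j φ := by
  induction ys generalizing N with
  | nil =>
    refine ⟨fun i hi => C.isEmpty_of_length_lt hC hxs h𝔪.ge hi, fun j hj φ hφ => ?_⟩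
    exact C.isCoboundary_of_isWeaklyRegular xs hxs.toIsWeaklyRegular
      (fun x hx => by simpa using hnil x hx) hj hφ
  | cons y ys ih =>
    obtain ⟨hy, hys⟩ := (isWeaklyRegular_cons_iff _ _ _).1 hys
    have hy𝔪 := hys𝔪 y List.mem_cons_self
    let π := Submodule.mkQ (y • (⊤ : Submodule R N))
    have hπ : Function.Surjective π := Submodule.mkQ_surjective _
    have hker : ∀ x, π x = 0 ↔ ∃ z, y • z = x := fun x => mkQ_quotSMulTop_eq_zero_iff
    obtain ⟨h1, h2⟩ := ih (C.cone hy π hπ hker) (C.cone_isMinimal hy π hπ hker hC hy𝔪) hys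
      (fun z hz => hys𝔪 z (List.mem_cons_of_mem _ hz)) (by
        intro x hx
        obtain ⟨k, hk⟩ := hnil x hx
        refine ⟨k, fun v => ?_⟩
        obtain ⟨v, rfl⟩ := hπ v
        have := hk v
        rw [Ideal.ofList_cons_smul, Submodule.mem_sup] at this
        obtain ⟨u, hu, w, hw, huw⟩ := this
        rw [← map_smul, ← huw, map_add, (hker u).2
          (by simpa [Submodule.mem_smul_pointwise_iff_exists] using hu), zero_add]
        have h2 := Submodule.mem_map_of_mem (f := π) hw
        rw [Submodule.map_smul''] at h2
        exact Submodule.smul_mono le_rfl le_top h2)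
    simp only [List.length_cons]
    constructor
    · intro i hi
      have := h1 (i + 1) (by omega)
      exact (isEmpty_sum.1 (show IsEmpty (C.ι (i + 1) ⊕ C.ι i) from this)).2
    · intro j hj φ hφ
      let Z : Submodule R ((C.ι j → R) →ₗ[R] R) := LinearMap.ker (LinearMap.lcomp R R (C.d j))
      have hZ : ∀ ψ, ψ ∈ Z ↔ ψ ∘ₗ C.d j = 0 := fun ψ => Iff.rfl
      have hle : Z ≤ C.coboundaries j ⊔ 𝔪 • Z := by
        intro ψ hψ
        obtain ⟨ψ', hψ', hsub⟩ := C.exists_isCoboundary_sub_smul hy π hπ hker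
          (h2 (j + 1) (by omega)) hψ
        rw [← sub_add_cancel ψ (y • ψ')]
        exact Submodule.add_mem_sup hsub (Submodule.smul_mem_smul hy𝔪 ((hZ ψ').2 hψ'))
      exact Submodule.le_of_le_smul_of_le_jacobson_bot (IsNoetherian.noetherian Z) hjac hle hφ

end Local

/-! ### Localization of resolutions -/

section Localization

variable {S : Type*} [CommRing S] {N : Type*} [AddCommGroup N] [Module S N]

/-- The componentwise map `S^ι → R^ι` for an `S`-algebra `R`. -/
def piAlgebraMap (S R : Type*) [CommRing S] [CommRing R] [Algebra S R] (ι : Type*) :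
    (ι → S) →ₗ[S] (ι → R) :=
  LinearMap.pi fun b => Algebra.linearMap S R ∘ₗ LinearMap.proj b

variable (T : Submonoid S) (R : Type*) [CommRing R] [Algebra S R] [IsLocalization T R]

instance (ι : Type*) [Finite ι] : IsLocalizedModule T (piAlgebraMap S R ι) :=
  inferInstanceAs (IsLocalizedModule T
    (LinearMap.pi fun b : ι => Algebra.linearMap S R ∘ₗ LinearMap.proj b))

/-- The localization of a free resolution. -/
noncomputable def localize (C : FreeResolution S N) {N' : Type*} [AddCommGroup N'] [Module S N']
    [Module R N'] [IsScalarTower S R N'] (g : N →ₗ[S] N') [IsLocalizedModule T g] :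
    FreeResolution R N' where
  ι := C.ι
  finite := C.finite
  aug := IsLocalizedModule.mapExtendScalars T (piAlgebraMap S R (C.ι 0)) g R C.aug
  d i := IsLocalizedModule.mapExtendScalars T (piAlgebraMap S R (C.ι (i + 1)))
    (piAlgebraMap S R (C.ι i)) R (C.d i)
  aug_surjective := IsLocalizedModule.map_surjective T (piAlgebraMap S R (C.ι 0)) g C.aug
    C.aug_surjective
  exact_zero := IsLocalizedModule.map_exact T (piAlgebraMap S R (C.ι 1))
    (piAlgebraMap S R (C.ι 0)) g _ _ C.exact_zero
  exact_succ i := IsLocalizedModule.map_exact T (piAlgebraMap S R (C.ι (i + 1 + 1)))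
    (piAlgebraMap S R (C.ι (i + 1))) (piAlgebraMap S R (C.ι i)) _ _ (C.exact_succ i)

variable (C : FreeResolution S N) {N' : Type*} [AddCommGroup N'] [Module S N']
    [Module R N'] [IsScalarTower S R N'] (g : N →ₗ[S] N') [IsLocalizedModule T g]

theorem localize_d_apply (i : ℕ) (v : C.ι (i + 1) → S) :
    (C.localize T R g).d i (piAlgebraMap S R _ v) = piAlgebraMap S R _ (C.d i v) :=
  IsLocalizedModule.map_apply T (piAlgebraMap S R (C.ι (i + 1))) (piAlgebraMap S R (C.ι i))
    (C.d i) v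

theorem piAlgebraMap_single {ι : Type*} [DecidableEq ι] (b : ι) :
    piAlgebraMap S R ι (Pi.single b 1) = Pi.single b 1 := by
  funext a
  by_cases h : a = b
  · subst h; simp [piAlgebraMap]
  · simp [piAlgebraMap, h]

theorem localize_d_single (i : ℕ) [DecidableEq (C.ι (i + 1))] (b : C.ι (i + 1)) :
    (C.localize T R g).d i (Pi.single (M := fun _ : C.ι (i + 1) => R) b 1) =
      piAlgebraMap S R _ (C.d i (Pi.single b 1)) :=
  (congrArg _ (piAlgebraMap_single R b).symm).trans (C.localize_d_apply T R g i _)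

theorem localize_isMinimal {𝔪 : Ideal S} (hC : C.IsMinimal 𝔪) :
    (C.localize T R g).IsMinimal (𝔪.map (algebraMap S R)) := by
  classical
  intro i v a
  have := Fintype.ofFinite ((C.localize T R g).ι (i + 1))
  rw [apply_eq_sum ((C.localize T R g).d i) v, Finset.sum_apply]
  refine Ideal.sum_mem _ fun b _ => Ideal.mul_mem_left _ _ ?_
  refine (congrFun (C.localize_d_single T R g i b) a).symm ▸ Ideal.mem_map_of_mem _ (hC _ _ _)

end Localization

/-! ### Cohen–Macaulay quotients -/

section CohenMacaulay

open RingTheory.Sequence Pointwise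

/-- In a Noetherian Cohen–Macaulay local ring some regular sequence `rs` has the property that
every non-unit is nilpotent modulo `rs`. -/
theorem exists_isRegular_and_pow_mem {A : Type*} [CommRing A] [IsLocalRing A] [IsNoetherianRing A]
    (hA : IsCohenMacaulayLocal A) :
    ∃ rs : List A, IsRegular A rs ∧
      ∀ x ∈ IsLocalRing.maximalIdeal A, ∃ k : ℕ, x ^ k ∈ Ideal.ofList rs := by
  obtain ⟨rs, hrs, hdim⟩ := hA
  refine ⟨rs, hrs, fun x hx => ?_⟩
  have hne : Ideal.ofList rs ≠ ⊤ := fun h => hrs.top_ne_smul (by rw [h]; simp)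
  have := Ideal.Quotient.nontrivial_iff.2 hne
  have h1 := ringKrullDim_add_length_eq_ringKrullDim_of_isRegular rs hrs
  rw [← hdim] at h1
  have h0 : ringKrullDim (A ⧸ Ideal.ofList rs) = 0 := by
    generalize ringKrullDim (A ⧸ Ideal.ofList rs) = t at h1
    cases t with
    | bot => simp at h1
    | coe t =>
      have h2 : t + rs.length = rs.length := by exact_mod_cast h1
      have h3 : t = 0 := by
        cases t with
        | top => simp at h2
        | coe t =>
          have h4 : t + rs.length = rs.length := by exact_mod_cast h2
          have h5 : t = 0 := by omega
          rw [h5]; rfl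
      rw [h3]; rfl
  have := ringKrullDimZero_iff_ringKrullDim_eq_zero.2 h0
  have : IsLocalRing (A ⧸ Ideal.ofList rs) :=
    IsLocalRing.of_surjective' (Ideal.Quotient.mk _) Ideal.Quotient.mk_surjective
  have hx' : Ideal.Quotient.mk (Ideal.ofList rs) x ∈ nilradical (A ⧸ Ideal.ofList rs) := by
    rw [← Ring.jacobson_eq_nilradical_of_krullDimLE_zero]
    rw [IsLocalRing.ringJacobson_eq_maximalIdeal]
    have := IsLocalHom.of_surjective (Ideal.Quotient.mk (Ideal.ofList rs))
      Ideal.Quotient.mk_surjective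
    exact fun h => hx (isUnit_of_map_unit _ x h)
  obtain ⟨k, hk⟩ := mem_nilradical.1 hx'
  exact ⟨k, Ideal.Quotient.eq_zero_iff_mem.1 (by rwa [map_pow])⟩

/-- Let the maximal ideal `𝔪` of `S` be generated by a regular sequence, let `I ⊆ 𝔪` be an ideal
such that the localization `A` of `S ⧸ I` at `𝔪` is Cohen–Macaulay, and let `C` be a minimal free
resolution of `S ⧸ I` with `C_p ≠ 0`. Then no cocycle of `Hom(C, S)` in degree `j < p` takes a value
outside `𝔪`, because it becomes a coboundary over `S_𝔪`. -/
theorem cocycle_apply_mem {S : Type*} [CommRing S] [IsNoetherianRing S] {𝔪 : Ideal S}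
    [h𝔪max : 𝔪.IsMaximal] {xs : List S} (hxs : IsWeaklyRegular S xs) (h𝔪 : Ideal.ofList xs = 𝔪)
    {I : Ideal S} (A : Type*) [CommRing A] [IsLocalRing A] [Algebra S A]
    [Algebra (S ⧸ I) A] [IsScalarTower S (S ⧸ I) A]
    [IsLocalization (Algebra.algebraMapSubmonoid (S ⧸ I) 𝔪.primeCompl) A]
    (hA : IsCohenMacaulayLocal A) (C : FreeResolution S (S ⧸ I)) (hC : C.IsMinimal 𝔪) {p : ℕ}
    (hp : Nonempty (C.ι p)) {j : ℕ} (hj : j < p) (φ : (C.ι j → S) →ₗ[S] S)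
    (hφ : φ ∘ₗ C.d j = 0) (v : C.ι j → S) : φ v ∈ 𝔪 := by
  classical
  let g : (S ⧸ I) →ₗ[S] A := (IsScalarTower.toAlgHom S (S ⧸ I) A).toLinearMap
  have hg : IsLocalizedModule 𝔪.primeCompl g := inferInstance
  let R := Localization.AtPrime 𝔪
  have hunit : ∀ y : 𝔪.primeCompl, IsUnit (algebraMap S A y) := fun y => by
    rw [IsScalarTower.algebraMap_apply S (S ⧸ I) A]
    exact IsLocalization.map_units A
      (⟨_, Algebra.mem_algebraMapSubmonoid_of_mem y⟩ :
        Algebra.algebraMapSubmonoid (S ⧸ I) 𝔪.primeCompl)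
  let : Algebra R A := (IsLocalization.lift (S := R) hunit).toAlgebra
  have : IsScalarTower S R A := IsScalarTower.of_algebraMap_eq fun x =>
    (IsLocalization.lift_eq hunit x).symm
  have hsurj : Function.Surjective (algebraMap R A) := by
    intro a
    obtain ⟨⟨q, t⟩, hqt⟩ := IsLocalizedModule.surj 𝔪.primeCompl g a
    obtain ⟨s, rfl⟩ := Ideal.Quotient.mk_surjective q
    refine ⟨IsLocalization.mk' R s t, ?_⟩
    refine (hunit t).mul_left_cancel ?_
    have h1 : algebraMap S A t * a = algebraMap S A s := by
      rw [← Algebra.smul_def]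
      refine hqt.trans ?_
      rw [IsScalarTower.algebraMap_apply S (S ⧸ I) A]
      rfl
    rw [h1, IsScalarTower.algebraMap_apply S R A, ← map_mul, IsLocalization.mk'_spec',
      ← IsScalarTower.algebraMap_apply]
  have : IsNoetherianRing A := isNoetherianRing_of_surjective R A _ hsurj
  have hxs𝔪 : ∀ x ∈ xs, x ∈ 𝔪 := fun x hx => h𝔪 ▸ Ideal.subset_span hx
  have hxsR := hxs.isRegular_of_isLocalization_of_mem R 𝔪 hxs𝔪
  have hmax : Ideal.ofList (xs.map (algebraMap S R)) = IsLocalRing.maximalIdeal R := by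
    rw [← Ideal.map_ofList, h𝔪, Localization.AtPrime.map_eq_maximalIdeal]
  have hmin : (C.localize 𝔪.primeCompl R g).IsMinimal (IsLocalRing.maximalIdeal R) := by
    rw [← Localization.AtPrime.map_eq_maximalIdeal]
    exact C.localize_isMinimal _ _ _ hC
  have : IsLocalHom (algebraMap R A) := IsLocalHom.of_surjective _ hsurj
  have hlocal : ∀ x ∈ IsLocalRing.maximalIdeal R, algebraMap R A x ∈ IsLocalRing.maximalIdeal A :=
    fun x hx h => hx (isUnit_of_map_unit (algebraMap R A) x h)
  obtain ⟨rs, hrs, hnil⟩ := exists_isRegular_and_pow_mem hA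
  obtain ⟨ys, rfl⟩ := hsurj.list_map rs
  have hys𝔪 : ∀ y ∈ ys, y ∈ IsLocalRing.maximalIdeal R := by
    intro y hy
    by_contra hy'
    rw [IsLocalRing.mem_maximalIdeal, mem_nonunits_iff, not_not] at hy'
    refine hrs.top_ne_smul ?_
    have hmem : algebraMap R A y ∈ Ideal.ofList (ys.map (algebraMap R A)) :=
      Ideal.subset_span (List.mem_map_of_mem hy)
    rw [Ideal.eq_top_of_isUnit_mem _ hmem (hy'.map (algebraMap R A))]
    simp
  have hsmul : (Ideal.ofList ys • (⊤ : Submodule R A)) =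
      (Ideal.ofList (ys.map (algebraMap R A))).restrictScalars R := by
    rw [Ideal.smul_top_eq_map, Ideal.map_ofList]
  obtain ⟨h1, h2⟩ := isEmpty_and_isCoboundary_of_isWeaklyRegular
    (IsLocalRing.maximalIdeal_le_jacobson _) hxsR hmax (C.localize 𝔪.primeCompl R g) hmin ys
    ((isWeaklyRegular_map_algebraMap_iff A A ys).1 hrs.toIsWeaklyRegular) hys𝔪 (by
      intro x hx
      obtain ⟨k, hk⟩ := hnil _ (hlocal x (hmax ▸ Ideal.subset_span hx))
      refine ⟨k, fun v => ?_⟩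
      rw [hsmul, Algebra.smul_def, map_pow]
      exact Ideal.mul_mem_right _ _ hk)
  have hple : p + ys.length ≤ (xs.map (algebraMap S R)).length := by
    by_contra h
    exact (not_isEmpty_iff.2 hp) (h1 p (by omega))
  let φ' : (C.ι j → R) →ₗ[R] R := IsLocalizedModule.mapExtendScalars 𝔪.primeCompl
    (piAlgebraMap S R (C.ι j)) (Algebra.linearMap S R) R φ
  have hφ' : ∀ w, φ' (piAlgebraMap S R _ w) = algebraMap S R (φ w) := fun w =>
    IsLocalizedModule.map_apply 𝔪.primeCompl (piAlgebraMap S R (C.ι j)) (Algebra.linearMap S R) φ w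
  have h3 : (C.localize 𝔪.primeCompl R g).IsCoboundary j φ' := by
    refine h2 j (by omega) φ' ((Pi.basisFun R _).ext fun b => ?_)
    have h4 := C.localize_d_single 𝔪.primeCompl R g j b
    have h5 : φ (C.d j (Pi.single b 1)) = 0 := LinearMap.congr_fun hφ _
    have h6 := hφ' (C.d j (Pi.single b 1))
    rw [h5, map_zero] at h6
    rw [Pi.basisFun_apply]
    exact (congrArg φ' h4).trans h6
  have h7 := (h3.comp (LinearMap.pi fun _ : Unit => LinearMap.id)).apply_mem hmin
    (piAlgebraMap S R _ v) ()
  have h8 : algebraMap S R (φ v) ∈ IsLocalRing.maximalIdeal R := hφ' v ▸ h7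
  exact (IsLocalization.AtPrime.to_map_mem_maximal_iff R 𝔪 _).1 h8

end CohenMacaulay

/-! ### Projective dimension -/

section ProjectiveDimension

open CategoryTheory

universe u

variable {R : Type u} [CommRing R] {N : Type u} [AddCommGroup N] [Module R N]

/-- The resolution of the first syzygy module, the kernel of the augmentation. -/
def syzygy (C : FreeResolution R N) : FreeResolution R (LinearMap.ker C.aug) where
  ι i := C.ι (i + 1)
  finite i := C.finite (i + 1)
  aug := (C.d 0).codRestrict _ C.aug_d
  d i := C.d (i + 1)
  aug_surjective v := by
    obtain ⟨w, hw⟩ := (C.exact_zero v).1 v.2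
    exact ⟨w, Subtype.ext hw⟩
  exact_zero v := by
    rw [← C.exact_succ 0 v, ← Subtype.coe_inj]
    rfl
  exact_succ i := C.exact_succ (i + 1)

theorem isEmpty_zero_of_subsingleton (C : FreeResolution R N) {𝔪 : Ideal R} (h𝔪 : 𝔪 ≠ ⊤)
    (hC : C.IsMinimal 𝔪) [Subsingleton N] : IsEmpty (C.ι 0) := by
  classical
  refine ⟨fun b => h𝔪 ((Ideal.eq_top_iff_one _).2 ?_)⟩
  obtain ⟨w, hw⟩ := (C.exact_zero (Pi.single b 1)).1 (Subsingleton.elim _ _)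
  have := hC 0 w b
  rwa [hw, Pi.single_eq_same] at this

theorem hasProjectiveDimensionLT_of_isEmpty (C : FreeResolution R N) {q : ℕ}
    (h : IsEmpty (C.ι q)) : HasProjectiveDimensionLT (ModuleCat.of R N) q := by
  induction q generalizing N with
  | zero =>
    have : Subsingleton N := C.aug_surjective.subsingleton
    exact (ModuleCat.isZero_of_subsingleton _).hasProjectiveDimensionLT_zero
  | succ q ih =>
    have := ih C.syzygy h
    have hfree : HasProjectiveDimensionLT (ModuleCat.of R (C.ι 0 → R)) (q + 1) :=
      hasProjectiveDimensionLT_of_ge _ 1 _ (by omega)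
    exact (LinearMap.shortExact_shortComplexKer C.aug_surjective).hasProjectiveDimensionLT_X₃ q
      this hfree

/-- If `N` is projective, then a minimal resolution of `N` over a domain stops in degree `0`: the
first syzygy `Z` is a direct summand of `C₀` contained in `𝔪 C₀`, so `Z = 𝔪 Z`, and Nakayama's lemma
gives a nonzero element of `R` that annihilates the torsion-free module `Z`. -/
theorem isEmpty_one_of_projective [IsDomain R] (C : FreeResolution R N) {𝔪 : Ideal R}
    (h𝔪 : 𝔪 ≠ ⊤) (hC : C.IsMinimal 𝔪) [Module.Projective R N] : IsEmpty (C.ι 1) := by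
  classical
  obtain ⟨s, hs⟩ := Module.projective_lifting_property C.aug LinearMap.id C.aug_surjective
  let e : (C.ι 0 → R) →ₗ[R] (C.ι 0 → R) := LinearMap.id - s ∘ₗ C.aug
  let Z := LinearMap.range (C.d 0)
  have he : ∀ v, e v ∈ Z := fun v => (C.exact_zero _).1 (by
    have := LinearMap.congr_fun hs (C.aug v)
    simp only [LinearMap.comp_apply, LinearMap.id_apply] at this
    simp [e, this])
  have heZ : ∀ v ∈ Z, e v = v := by
    rintro _ ⟨w, rfl⟩
    simp [e, C.aug_d]
  have hle : Z ≤ 𝔪 • Z := by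
    intro v hv
    obtain ⟨w, rfl⟩ := hv
    have := Fintype.ofFinite (C.ι 0)
    rw [← heZ _ ⟨w, rfl⟩, apply_eq_sum e]
    exact Submodule.sum_mem _ fun b _ => Submodule.smul_mem_smul (hC 0 w b) (he _)
  obtain ⟨r, hr, hrZ⟩ := Submodule.exists_sub_one_mem_and_smul_eq_zero_of_fg_of_le_smul 𝔪 Z
    (Module.Finite.iff_fg.1 (Module.Finite.range (C.d 0))) hle
  have hr0 : r ≠ 0 := by
    rintro rfl
    refine h𝔪 ((Ideal.eq_top_iff_one _).2 ?_)
    simpa using hr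
  have hd : ∀ w, C.d 0 w = 0 := fun w => by
    have := hrZ _ ⟨w, rfl⟩
    exact (smul_eq_zero.1 this).resolve_left hr0
  refine ⟨fun b => h𝔪 ((Ideal.eq_top_iff_one _).2 ?_)⟩
  obtain ⟨w, hw⟩ := (C.exact_succ 0 (Pi.single b 1)).1 (hd _)
  have := hC 1 w b
  rwa [hw, Pi.single_eq_same] at this

theorem isEmpty_of_hasProjectiveDimensionLT [IsDomain R] (C : FreeResolution R N) {𝔪 : Ideal R}
    (h𝔪 : 𝔪 ≠ ⊤) (hC : C.IsMinimal 𝔪) {q : ℕ}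
    (h : HasProjectiveDimensionLT (ModuleCat.of R N) q) : IsEmpty (C.ι q) := by
  induction q generalizing N with
  | zero =>
    have : Subsingleton N := ModuleCat.isZero_iff_subsingleton.1
      (isZero_of_hasProjectiveDimensionLT_zero (ModuleCat.of R N))
    exact C.isEmpty_zero_of_subsingleton h𝔪 hC
  | succ q ih =>
    cases q with
    | zero =>
      have : Module.Projective R N := (IsProjective.iff_projective N).2
        (inferInstanceAs (Projective (ModuleCat.of R N)))
      exact C.isEmpty_one_of_projective h𝔪 hC
    | succ q =>
      have hfree : HasProjectiveDimensionLT (ModuleCat.of R (C.ι 0 → R)) (q + 1) :=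
        hasProjectiveDimensionLT_of_ge _ 1 _ (by omega)
      exact ih C.syzygy (fun i => hC (i + 1))
        ((LinearMap.shortExact_shortComplexKer C.aug_surjective).hasProjectiveDimensionLT_X₁
          (q + 1) hfree h)

/-- The projective dimension is the length of a minimal free resolution. -/
theorem nonempty_iff_le_projectiveDimension [IsDomain R] (C : FreeResolution R N) {𝔪 : Ideal R}
    (h𝔪 : 𝔪 ≠ ⊤) (hC : C.IsMinimal 𝔪) {p : ℕ}
    (hp : projectiveDimension (ModuleCat.of R N) = p) (i : ℕ) :
    Nonempty (C.ι i) ↔ i ≤ p := by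
  have key : IsEmpty (C.ι i) ↔ (p : WithBot ℕ∞) < i := by
    rw [← hp, projectiveDimension_lt_iff]
    exact ⟨C.hasProjectiveDimensionLT_of_isEmpty, C.isEmpty_of_hasProjectiveDimensionLT h𝔪 hC⟩
  rw [← not_isEmpty_iff, key, not_lt]
  exact_mod_cast Iff.rfl

end ProjectiveDimension

end FreeResolution

/-! ### Ideals generated by linear forms -/

section LinearForms

variable {K : Type*} [Field K] {n : ℕ}

/-- For a space `W` of linear forms and a linear projection `π` of `S` with kernel `W`, the
substitution `x_i ↦ π(x_i)` has kernel the ideal generated by `W`, and it agrees with `π` on linear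
forms. -/
theorem exists_aeval_ker (W : Submodule K (MvPolynomial (Fin n) K))
    (hW : W ≤ homogeneousSubmodule (Fin n) K 1) :
    ∃ φ : MvPolynomial (Fin n) K →ₐ[K] MvPolynomial (Fin n) K,
      RingHom.ker φ = Ideal.span (W : Set (MvPolynomial (Fin n) K)) ∧
      ∀ l ∈ homogeneousSubmodule (Fin n) K 1, φ l = 0 → l ∈ W := by
  obtain ⟨U, hU⟩ := W.exists_isCompl
  let π := U.projection W hU.symm
  have hker : ∀ v, π v = 0 ↔ v ∈ W := fun v => Submodule.projection_apply_eq_zero_iff hU.symm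
  have hsub : ∀ v, π v - v ∈ W := fun v => by
    rw [← hker, map_sub, sub_eq_zero]
    exact Submodule.projection_apply_of_mem_left hU.symm (Submodule.projection_apply_mem hU.symm v)
  let φ : MvPolynomial (Fin n) K →ₐ[K] MvPolynomial (Fin n) K := aeval fun i => π (X i)
  have hφ : ∀ l ∈ homogeneousSubmodule (Fin n) K 1, φ l = π l := by
    intro l hl
    rw [homogeneousSubmodule_one_eq_span_X] at hl
    refine LinearMap.eqOn_span (f := φ.toLinearMap) ?_ hl
    rintro _ ⟨i, rfl⟩
    exact aeval_X _ i
  have hmod : ∀ g, Ideal.Quotient.mk (Ideal.span (W : Set (MvPolynomial (Fin n) K))) (φ g) =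
      Ideal.Quotient.mk _ g := by
    intro g
    have : (Ideal.Quotient.mkₐ K (Ideal.span (W : Set (MvPolynomial (Fin n) K)))).comp φ =
        Ideal.Quotient.mkₐ K _ := by
      refine algHom_ext fun i => ?_
      refine Ideal.Quotient.eq.2 (Ideal.subset_span ?_)
      simp only [φ, RingHom.coe_coe, aeval_X]
      exact hsub _
    exact DFunLike.congr_fun this g
  refine ⟨φ, le_antisymm (fun g hg => ?_) (Ideal.span_le.2 fun l hl => ?_), fun l hl h => ?_⟩
  · rw [← Ideal.Quotient.eq_zero_iff_mem, ← hmod, (RingHom.mem_ker).1 hg, map_zero]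
  · exact (RingHom.mem_ker).2 ((hφ l (hW hl)).trans ((hker l).2 hl))
  · rwa [hφ l hl, hker] at h

theorem isSMulRegular_quotient_span (W : Submodule K (MvPolynomial (Fin n) K))
    (hW : W ≤ homogeneousSubmodule (Fin n) K 1) {l : MvPolynomial (Fin n) K}
    (hl : l ∈ homogeneousSubmodule (Fin n) K 1) (hlW : l ∉ W) :
    IsSMulRegular (MvPolynomial (Fin n) K ⧸ Ideal.span (W : Set (MvPolynomial (Fin n) K))) l := by
  obtain ⟨φ, hφ, hφl⟩ := exists_aeval_ker W hW
  refine isSMulRegular_iff_right_eq_zero_of_smul.2 fun v hv => ?_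
  obtain ⟨v, rfl⟩ := Ideal.Quotient.mk_surjective v
  have h1 : l * v ∈ RingHom.ker φ := by
    rw [hφ]
    exact Ideal.Quotient.eq_zero_iff_mem.1 hv
  rw [RingHom.mem_ker, map_mul, mul_eq_zero] at h1
  refine Ideal.Quotient.eq_zero_iff_mem.2 ?_
  rw [← hφ]
  exact h1.resolve_left fun h => hlW (hφl l hl h)

/-- The ideal generated by the variables. -/
noncomputable abbrev irrelevantIdeal (K : Type*) [Field K] (n : ℕ) :
    Ideal (MvPolynomial (Fin n) K) :=
  RingHom.ker (constantCoeff (R := K) (σ := Fin n))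

instance : (irrelevantIdeal K n).IsMaximal :=
  RingHom.ker_isMaximal_of_surjective _ fun a => ⟨C a, constantCoeff_C _ a⟩

/-- The variables, as a list. -/
noncomputable def variableList (K : Type*) [Field K] (n : ℕ) : List (MvPolynomial (Fin n) K) :=
  List.ofFn X

theorem ofList_variableList : Ideal.ofList (variableList K n) = irrelevantIdeal K n := by
  have h : ({x | x ∈ variableList K n} : Set _) = X '' (Set.univ : Set (Fin n)) := by
    ext x
    simp [variableList, List.mem_ofFn]
  refine le_antisymm (Ideal.span_le.2 ?_) fun g hg => ?_
  · rw [h]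
    rintro _ ⟨i, -, rfl⟩
    simp
  · rw [Ideal.ofList, h, mem_ideal_span_X_image]
    intro m hm
    have : m ≠ 0 := by
      rintro rfl
      exact MvPolynomial.mem_support_iff.1 hm (RingHom.mem_ker.1 hg :)
    obtain ⟨i, hi⟩ := Finsupp.ne_iff.1 this
    exact ⟨i, trivial, hi⟩

theorem isWeaklyRegular_variableList :
    RingTheory.Sequence.IsWeaklyRegular (MvPolynomial (Fin n) K) (variableList K n) := by
  refine ⟨fun i hi => ?_⟩
  have hin : i < n := by simpa [variableList] using hi
  let T : Set (MvPolynomial (Fin n) K) := X '' {j : Fin n | (j : ℕ) < i}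
  have hT : {x | x ∈ (variableList K n).take i} = T := by
    ext x
    simp only [variableList, Set.mem_ofPred_eq, T, Set.mem_image]
    rw [List.mem_take_iff_getElem]
    constructor
    · rintro ⟨j, hj, rfl⟩
      simp only [List.length_ofFn] at hj
      exact ⟨⟨j, by omega⟩, by simp; omega, by simp⟩
    · rintro ⟨j, hj, rfl⟩
      exact ⟨j, by simp; omega, by simp⟩
  have hspan : Ideal.ofList ((variableList K n).take i) • (⊤ : Ideal (MvPolynomial (Fin n) K)) =
      Ideal.span (Submodule.span K T : Set (MvPolynomial (Fin n) K)) := by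
    rw [smul_eq_mul, Ideal.mul_top, Ideal.ofList, hT]
    refine le_antisymm (Ideal.span_mono Submodule.subset_span) (Ideal.span_le.2 fun x hx => ?_)
    exact Submodule.span_subset_span K (MvPolynomial (Fin n) K) T hx
  have hX : ∀ j : Fin n, (X j : MvPolynomial (Fin n) K) ∈ homogeneousSubmodule (Fin n) K 1 :=
    fun j => isHomogeneous_X K j
  have hget : (variableList K n)[i] = X ⟨i, hin⟩ := by simp [variableList]
  rw [hget, hspan]
  refine isSMulRegular_quotient_span _ (Submodule.span_le.2 ?_) (hX _) fun hmem => ?_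
  · rintro _ ⟨j, -, rfl⟩
    exact hX j
  · have hle : Submodule.span K T ≤ LinearMap.ker
        (lcoeff K (Finsupp.single (⟨i, hin⟩ : Fin n) 1)) := by
      refine Submodule.span_le.2 ?_
      rintro _ ⟨j, hj, rfl⟩
      have : j ≠ ⟨i, hin⟩ := fun h => by simp [h] at hj
      simp only [SetLike.mem_coe, LinearMap.mem_ker, lcoeff_apply, coeff_X]
      rw [if_neg]
      exact fun h => this (Finsupp.single_left_injective one_ne_zero h)
    have := hle hmem
    simp at this

end LinearForms

/-! ### Cocycles of a resolution of a Cohen–Macaulay quotient -/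

/-- In a minimal resolution of length at least `p` of a Cohen–Macaulay quotient of `S`, cocycles of
`Hom(C, S)` in degrees below `p` have values in `(x₁, …, xₙ)`. -/
theorem cocycle_apply_mem_irrelevantIdeal {K : Type*} [Field K] {n : ℕ}
    {I : Ideal (MvPolynomial (Fin n) K)} (hI : I ≤ irrelevantIdeal K n)
    (hCM : IsCohenMacaulay (MvPolynomial (Fin n) K ⧸ I))
    (C : FreeResolution (MvPolynomial (Fin n) K) (MvPolynomial (Fin n) K ⧸ I))
    (hC : C.IsMinimal (irrelevantIdeal K n)) {p : ℕ} (hp : Nonempty (C.ι p)) {j : ℕ} (hj : j < p)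
    (φ : (C.ι j → MvPolynomial (Fin n) K) →ₗ[MvPolynomial (Fin n) K] MvPolynomial (Fin n) K)
    (hφ : φ ∘ₗ C.d j = 0) (v) : φ v ∈ irrelevantIdeal K n := by
  let 𝔫 := (irrelevantIdeal K n).map (Ideal.Quotient.mk I)
  have hmem : ∀ x, Ideal.Quotient.mk I x ∈ 𝔫 ↔ x ∈ irrelevantIdeal K n := fun x =>
    Ideal.mem_quotient_iff_mem hI
  have hmax : 𝔫.IsMaximal := by
    refine (Ideal.map_eq_top_or_isMaximal_of_surjective _ Ideal.Quotient.mk_surjective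
      inferInstance).resolve_left fun h => ?_
    have h1 := (hmem 1).1 ((Ideal.eq_top_iff_one _).1 h)
    simp at h1
  have hcompl : Algebra.algebraMapSubmonoid (MvPolynomial (Fin n) K ⧸ I)
      (irrelevantIdeal K n).primeCompl = 𝔫.primeCompl := by
    ext x
    constructor
    · rintro ⟨y, hy, rfl⟩
      exact fun h => hy ((hmem y).1 h)
    · intro hx
      obtain ⟨y, rfl⟩ := Ideal.Quotient.mk_surjective x
      exact ⟨y, fun h => hx ((hmem y).2 h), rfl⟩
  have : IsLocalization (Algebra.algebraMapSubmonoid (MvPolynomial (Fin n) K ⧸ I)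
      (irrelevantIdeal K n).primeCompl) (Localization.AtPrime 𝔫) := by
    rw [hcompl]
    infer_instance
  exact FreeResolution.cocycle_apply_mem isWeaklyRegular_variableList ofList_variableList
    (Localization.AtPrime 𝔫) (hCM.localization 𝔫) C hC hp hj φ hφ v

/-! ### Graded resolutions and uniqueness of Betti numbers -/

section Graded

variable {K : Type*} [Field K] {n : ℕ}

theorem one_mem_polyDeg : (1 : MvPolynomial (Fin n) K) ∈ polyDeg K n 0 := by
  intro m hm
  rw [coeff_one] at hm
  split_ifs at hm with h
  · simp [← h]
  · exact absurd rfl hm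

theorem mul_mem_polyDeg {i j : ℤ} {g h : MvPolynomial (Fin n) K} (hg : g ∈ polyDeg K n i)
    (hh : h ∈ polyDeg K n j) : g * h ∈ polyDeg K n (i + j) :=
  (selfProj K n).smul i j g h hg hh

theorem mem_polyDeg_of_isHomogeneous {g : MvPolynomial (Fin n) K} {d : ℕ}
    (hg : g.IsHomogeneous d) : g ∈ polyDeg K n d := by
  intro m hm
  rw [← hg hm, Finsupp.degree_eq_weight_one]
  rfl

/-- A homogeneous polynomial with zero constant term has positive degree, or it is zero. -/
theorem eq_zero_of_mem_polyDeg {j : ℤ} {g : MvPolynomial (Fin n) K} (hg : g ∈ polyDeg K n j)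
    (h0 : constantCoeff g = 0) (hj : j ≤ 0) : g = 0 := by
  ext m
  by_contra hm
  have h1 := hg m hm
  have h2 : m.degree = 0 := by omega
  rw [Finsupp.degree_eq_zero_iff] at h2
  subst h2
  exact hm h0

theorem constantCoeff_eq_zero_of_mem_polyDeg {j : ℤ} {g : MvPolynomial (Fin n) K}
    (hg : g ∈ polyDeg K n j) (hj : j ≠ 0) : constantCoeff g = 0 := by
  by_contra h
  have := hg 0 h
  simp at this
  exact hj this.symm

/-- `v` is homogeneous of degree `j` in `⨁_b S(-deg b)`. -/
def IsHomogeneousVector {ι : Type*} (deg : ι → ℤ) (j : ℤ) (v : ι → MvPolynomial (Fin n) K) :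
    Prop :=
  ∀ b, v b ∈ polyDeg K n (j - deg b)

theorem isHomogeneousVector_single {ι : Type*} [DecidableEq ι] (deg : ι → ℤ) (b : ι) :
    IsHomogeneousVector (K := K) (n := n) deg (deg b) (Pi.single b 1) := by
  intro c
  by_cases h : c = b
  · subst h
    rw [Pi.single_eq_same, sub_self]
    exact one_mem_polyDeg
  · rw [Pi.single_eq_of_ne h]
    exact zero_mem _

theorem isHomogeneousVector_polyComp {ι : Type*} (deg : ι → ℤ) (j : ℤ)
    (w : ι → MvPolynomial (Fin n) K) :
    IsHomogeneousVector deg j fun b => polyComp K n (j - deg b) (w b) :=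
  fun b => (selfProj K n).mem (j - deg b) (w b)

section Maps

variable {ι κ : Type*} [Finite ι] (deg : ι → ℤ) (deg' : κ → ℤ) {M : Type*} [AddCommGroup M]
  [Module (MvPolynomial (Fin n) K) M] {ℳ : ℤ → AddSubgroup M}

/-- A linear map that is homogeneous of degree `-c` commutes with taking components. -/
theorem GradedProj.π_apply (P : GradedProj K n ℳ) (c : ℤ)
    (g : (ι → MvPolynomial (Fin n) K) →ₗ[MvPolynomial (Fin n) K] M)
    (hg : ∀ j v, IsHomogeneousVector deg j v → g v ∈ ℳ (j - c)) (j : ℤ)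
    (w : ι → MvPolynomial (Fin n) K) :
    P.π (j - c) (g w) = g fun b => polyComp K n (j - deg b) (w b) := by
  classical
  have := Fintype.ofFinite ι
  rw [apply_eq_sum g w, apply_eq_sum g fun b => polyComp K n (j - deg b) (w b), map_sum]
  refine Finset.sum_congr rfl fun b _ => ?_
  rw [P.π_smul (j - c) (deg b - c) _ _ (hg _ _ (isHomogeneousVector_single deg b)),
    sub_sub_sub_cancel_right]

/-- Homogeneous linear maps of degree `0`. -/
def IsHomogeneousMap
    (φ : (ι → MvPolynomial (Fin n) K) →ₗ[MvPolynomial (Fin n) K] (κ → MvPolynomial (Fin n) K)) :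
    Prop :=
  ∀ j v, IsHomogeneousVector deg j v → IsHomogeneousVector deg' j (φ v)

variable {deg deg'}

theorem IsHomogeneousMap.exists_preimage
    {φ : (ι → MvPolynomial (Fin n) K) →ₗ[MvPolynomial (Fin n) K] (κ → MvPolynomial (Fin n) K)}
    (hφ : IsHomogeneousMap deg deg' φ) {j : ℤ} {v : κ → MvPolynomial (Fin n) K}
    (hv : IsHomogeneousVector deg' j v) (h : ∃ w, φ w = v) :
    ∃ w, IsHomogeneousVector deg j w ∧ φ w = v := by
  obtain ⟨w, rfl⟩ := h
  refine ⟨_, isHomogeneousVector_polyComp deg j w, funext fun a => ?_⟩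
  have h1 := (selfProj K n).π_apply deg (deg' a) (LinearMap.proj a ∘ₗ φ)
    (fun j v hv => hφ j v hv a) j w
  exact h1.symm.trans ((selfProj K n).same _ _ (hv a))

theorem exists_isHomogeneousMap_comp_eq {Q : Type*} [AddCommGroup Q]
    [Module (MvPolynomial (Fin n) K) Q] [DecidableEq ι]
    (g : (κ → MvPolynomial (Fin n) K) →ₗ[MvPolynomial (Fin n) K] Q)
    (ψ : (ι → MvPolynomial (Fin n) K) →ₗ[MvPolynomial (Fin n) K] Q)
    (h : ∀ b, ∃ w, IsHomogeneousVector deg' (deg b) w ∧ g w = ψ (Pi.single b 1)) :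
    ∃ φ, IsHomogeneousMap deg deg' φ ∧ g ∘ₗ φ = ψ := by
  have := Fintype.ofFinite ι
  choose w hw hgw using h
  refine ⟨(Pi.basisFun _ ι).constr (MvPolynomial (Fin n) K) w, fun j v hv a => ?_, ?_⟩
  · rw [apply_eq_sum _ v, Finset.sum_apply]
    refine sum_mem fun b _ => ?_
    rw [← Pi.basisFun_apply, Module.Basis.constr_basis]
    have := mul_mem_polyDeg (hv b) (hw b a)
    rwa [sub_add_sub_cancel] at this
  · refine (Pi.basisFun _ ι).ext fun b => ?_
    rw [LinearMap.comp_apply, Module.Basis.constr_basis, hgw, Pi.basisFun_apply]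

end Maps

namespace FreeResolution

variable {M : Type*} [AddCommGroup M] [Module (MvPolynomial (Fin n) K) M]

/-- The resolution `C` is graded when the basis vector `b` of `C_i` is given the degree
`deg i b`. -/
structure IsGraded (C : FreeResolution (MvPolynomial (Fin n) K) M) (ℳ : ℤ → AddSubgroup M)
    (deg : ∀ i, C.ι i → ℤ) : Prop where
  aug_mem : ∀ j v, IsHomogeneousVector (deg 0) j v → C.aug v ∈ ℳ j
  d_mem : ∀ i, IsHomogeneousMap (deg (i + 1)) (deg i) (C.d i)

variable {ℳ : ℤ → AddSubgroup M}

theorem IsGraded.exists_preimage {C : FreeResolution (MvPolynomial (Fin n) K) M}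
    {deg : ∀ i, C.ι i → ℤ} (hC : C.IsGraded ℳ deg) (P : GradedProj K n ℳ) {j : ℤ} {v : M}
    (hv : v ∈ ℳ j) : ∃ w, IsHomogeneousVector (deg 0) j w ∧ C.aug w = v := by
  obtain ⟨w, rfl⟩ := C.aug_surjective v
  refine ⟨_, isHomogeneousVector_polyComp (deg 0) j w, ?_⟩
  have := P.π_apply (deg 0) 0 C.aug (fun j v hv => by rw [sub_zero]; exact hC.aug_mem j v hv) j w
  rw [sub_zero] at this
  exact this.symm.trans (P.same _ _ hv)

/-- Two graded resolutions of the same module can be compared by homogeneous maps `φ` and `ψ` whose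
composites are homotopic to the identity. -/
theorem IsGraded.exists_comparison {C D : FreeResolution (MvPolynomial (Fin n) K) M}
    {deg : ∀ i, C.ι i → ℤ} {deg' : ∀ i, D.ι i → ℤ} (hC : C.IsGraded ℳ deg)
    (hD : D.IsGraded ℳ deg') (P : GradedProj K n ℳ) (i : ℕ) :
    ∃ φ ψ, IsHomogeneousMap (deg i) (deg' i) φ ∧ IsHomogeneousMap (deg' i) (deg i) ψ ∧
      (∀ v, ∃ w, D.d i w = φ (C.d i v)) ∧ (∀ v, ∃ w, C.d i w = ψ (D.d i v)) ∧
      (∃ s, C.IsCoboundary i (ψ ∘ₗ φ - LinearMap.id - C.d i ∘ₗ s)) ∧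
      (∃ t, D.IsCoboundary i (φ ∘ₗ ψ - LinearMap.id - D.d i ∘ₗ t)) := by
  classical
  induction i with
  | zero =>
    obtain ⟨φ, hφ, hφ'⟩ := exists_isHomogeneousMap_comp_eq (deg := deg 0) D.aug C.aug fun b =>
      hD.exists_preimage P (hC.aug_mem _ _ (isHomogeneousVector_single _ b))
    obtain ⟨ψ, hψ, hψ'⟩ := exists_isHomogeneousMap_comp_eq (deg := deg' 0) C.aug D.aug fun b =>
      hC.exists_preimage P (hD.aug_mem _ _ (isHomogeneousVector_single _ b))
    have h1 : ∀ v, D.aug (φ v) = C.aug v := LinearMap.congr_fun hφ'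
    have h2 : ∀ v, C.aug (ψ v) = D.aug v := LinearMap.congr_fun hψ'
    refine ⟨φ, ψ, hφ, hψ, fun v => ?_, fun v => ?_, IsCoboundary.exists_homotopy_zero ?_,
      IsCoboundary.exists_homotopy_zero ?_⟩
    · exact (D.exact_zero _).1 (by rw [h1, C.aug_d])
    · exact (C.exact_zero _).1 (by rw [h2, D.aug_d])
    · exact LinearMap.ext fun v => by simp [h1, h2]
    · exact LinearMap.ext fun v => by simp [h1, h2]
  | succ i ih =>
    obtain ⟨φ, ψ, hφ, hψ, hφd, hψd, ⟨s, hs⟩, t, ht⟩ := ih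
    obtain ⟨φ', hφ', hφφ'⟩ := exists_isHomogeneousMap_comp_eq (deg := deg (i + 1)) (D.d i)
      (φ ∘ₗ C.d i) fun b => (hD.d_mem i).exists_preimage
        (hφ _ _ (hC.d_mem i _ _ (isHomogeneousVector_single _ b))) (hφd _)
    obtain ⟨ψ', hψ', hψψ'⟩ := exists_isHomogeneousMap_comp_eq (deg := deg' (i + 1)) (C.d i)
      (ψ ∘ₗ D.d i) fun b => (hC.d_mem i).exists_preimage
        (hψ _ _ (hD.d_mem i _ _ (isHomogeneousVector_single _ b))) (hψd _)
    have h1 : ∀ v, D.d i (φ' v) = φ (C.d i v) := LinearMap.congr_fun hφφ'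
    have h2 : ∀ v, C.d i (ψ' v) = ψ (D.d i v) := LinearMap.congr_fun hψψ'
    refine ⟨φ', ψ', hφ', hψ', fun v => ?_, fun v => ?_, hs.exists_homotopy_succ ?_,
      ht.exists_homotopy_succ ?_⟩
    · exact (D.exact_succ i _).1 (by rw [h1, C.d_d, map_zero])
    · exact (C.exact_succ i _).1 (by rw [h2, D.d_d, map_zero])
    · exact LinearMap.ext fun v => by simp [h1, h2]
    · exact LinearMap.ext fun v => by simp [h1, h2]

/-- Modulo the variables, the comparison maps of `exists_comparison` become inverse to each other
in every degree, as homotopies do not contribute to minimal resolutions. -/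
theorem IsGraded.card_le {C D : FreeResolution (MvPolynomial (Fin n) K) M}
    {deg : ∀ i, C.ι i → ℤ} {deg' : ∀ i, D.ι i → ℤ} (hC : C.IsGraded ℳ deg)
    (hD : D.IsGraded ℳ deg') (P : GradedProj K n ℳ) (hCmin : C.IsMinimal (irrelevantIdeal K n))
    (i : ℕ) (j : ℤ) :
    Nat.card {b // deg i b = j} ≤ Nat.card {b // deg' i b = j} := by
  classical
  have := Fintype.ofFinite (C.ι i)
  have := Fintype.ofFinite (D.ι i)
  obtain ⟨φ, ψ, hφ, hψ, -, -, ⟨s, hs⟩, -⟩ := hC.exists_comparison hD P i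
  let A : Matrix {c // deg' i c = j} {b // deg i b = j} K :=
    Matrix.of fun c b => constantCoeff (φ (Pi.single b.1 1) c)
  let B : Matrix {b // deg i b = j} {c // deg' i c = j} K :=
    Matrix.of fun b c => constantCoeff (ψ (Pi.single c.1 1) b)
  have hBA : B * A = 1 := by
    ext b' b
    have h1 : constantCoeff (ψ (φ (Pi.single b.1 1)) b'.1) = if b'.1 = b.1 then 1 else 0 := by
      have h2 := hs.apply_mem hCmin (Pi.single b.1 1) b'.1
      have h3 := hCmin i (s (Pi.single b.1 1)) b'.1
      simp only [RingHom.mem_ker, LinearMap.sub_apply, LinearMap.comp_apply, Pi.sub_apply,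
        LinearMap.id_apply, map_sub] at h2 h3
      rw [h3, sub_zero, sub_eq_zero] at h2
      rw [h2, Pi.single_apply]
      split_ifs <;> simp
    rw [apply_eq_sum ψ, Finset.sum_apply, map_sum] at h1
    rw [Matrix.mul_apply, Matrix.one_apply]
    simp only [Subtype.ext_iff]
    rw [← h1]
    have hzero : ∀ c : D.ι i, deg' i c ≠ j → constantCoeff (φ (Pi.single b.1 1) c) = 0 :=
      fun c hc => constantCoeff_eq_zero_of_mem_polyDeg
        (hφ _ _ (isHomogeneousVector_single _ b.1) c) (by rw [b.2]; omega)
    let f : D.ι i → K := fun c =>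
      constantCoeff ((φ (Pi.single b.1 1) c • ψ (Pi.single c 1)) b'.1)
    have hf : ∀ c, f c = constantCoeff (ψ (Pi.single c 1) b'.1) *
        constantCoeff (φ (Pi.single b.1 1) c) := fun c => by
      simp only [f, Pi.smul_apply, smul_eq_mul, map_mul, mul_comm]
    have hsum := Finset.sum_subtype (Finset.univ.filter fun c => deg' i c = j)
      (p := fun c => deg' i c = j) (F := inferInstance) (by simp) f
    rw [Finset.sum_filter_of_ne fun c _ hne => by
      by_contra hc
      exact hne (by rw [hf, hzero c hc, mul_zero])] at hsum
    refine Eq.trans ?_ hsum.symm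
    exact Finset.sum_congr rfl fun c _ => (hf c).symm
  have hinj : Function.Injective A.mulVecLin := by
    refine Function.LeftInverse.injective (g := B.mulVecLin) fun v => ?_
    rw [Matrix.mulVecLin_apply, Matrix.mulVecLin_apply, Matrix.mulVec_mulVec, hBA,
      Matrix.one_mulVec]
  have := LinearMap.finrank_le_finrank_of_injective hinj
  rwa [Module.finrank_fintype_fun_eq_card, Module.finrank_fintype_fun_eq_card,
    ← Nat.card_eq_fintype_card, ← Nat.card_eq_fintype_card] at this

end FreeResolution

/-- A minimal graded free resolution, with its grading forgotten. -/
def MinimalGradedFreeResolution.toFreeResolution {M : Type*} [AddCommGroup M]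
    [Module (MvPolynomial (Fin n) K) M] {ℳ : ℤ → AddSubgroup M}
    (F : MinimalGradedFreeResolution K n ℳ) : FreeResolution (MvPolynomial (Fin n) K) M where
  ι i := Fin (F.rank i)
  finite _ := inferInstance
  aug := F.aug
  d := F.d
  aug_surjective := F.aug_surjective
  exact_zero := F.exact_zero
  exact_succ := F.exact_succ

theorem MinimalGradedFreeResolution.isMinimal {M : Type*} [AddCommGroup M]
    [Module (MvPolynomial (Fin n) K) M] {ℳ : ℤ → AddSubgroup M}
    (F : MinimalGradedFreeResolution K n ℳ) :
    F.toFreeResolution.IsMinimal (irrelevantIdeal K n) := by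
  intro i (v : Fin (F.rank (i + 1)) → _) (a : Fin (F.rank i))
  change F.d i v a ∈ irrelevantIdeal K n
  rw [apply_eq_sum (F.d i), Finset.sum_apply]
  exact Ideal.sum_mem _ fun b _ => Ideal.mul_mem_left _ _ (F.minimal i b a)

theorem MinimalGradedFreeResolution.isGraded {M : Type*} [AddCommGroup M]
    [Module (MvPolynomial (Fin n) K) M] {ℳ : ℤ → AddSubgroup M}
    (F : MinimalGradedFreeResolution K n ℳ) (P : GradedProj K n ℳ) :
    F.toFreeResolution.IsGraded ℳ F.deg where
  aug_mem := by
    intro j (v : Fin (F.rank 0) → _) hv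
    change F.aug v ∈ ℳ j
    rw [apply_eq_sum F.aug]
    refine sum_mem fun b _ => ?_
    have := P.smul _ _ _ _ (hv b) (F.aug_homogeneous b)
    rwa [sub_add_cancel] at this
  d_mem := by
    intro i j (v : Fin (F.rank (i + 1)) → _) hv (a : Fin (F.rank i))
    change F.d i v a ∈ polyDeg K n (j - F.deg i a)
    rw [apply_eq_sum (F.d i), Finset.sum_apply]
    refine sum_mem fun b _ => ?_
    have := mul_mem_polyDeg (hv b) (F.d_homogeneous i b a)
    rwa [sub_add_sub_cancel] at this

/-- Graded Betti numbers can be computed from any minimal graded free resolution. -/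
theorem gradedBetti_eq {M : Type*} [AddCommGroup M] [Module (MvPolynomial (Fin n) K) M]
    {ℳ : ℤ → AddSubgroup M} (P : GradedProj K n ℳ)
    (h : Nonempty (MinimalGradedFreeResolution K n ℳ))
    {C : FreeResolution (MvPolynomial (Fin n) K) M} (hC : C.IsMinimal (irrelevantIdeal K n))
    {deg : ∀ i, C.ι i → ℤ} (hdeg : C.IsGraded ℳ deg) (i : ℕ) (j : ℤ) :
    gradedBetti K n ℳ i j = Nat.card {b // deg i b = j} := by
  rw [gradedBetti, dif_pos h, ← Nat.card_eq_fintype_card]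
  exact le_antisymm ((h.some.isGraded P).card_le hdeg P h.some.isMinimal i j)
    (hdeg.card_le (h.some.isGraded P) P hC i j)

theorem totalBetti_eq {M : Type*} [AddCommGroup M] [Module (MvPolynomial (Fin n) K) M]
    {ℳ : ℤ → AddSubgroup M} (P : GradedProj K n ℳ)
    (h : Nonempty (MinimalGradedFreeResolution K n ℳ))
    {C : FreeResolution (MvPolynomial (Fin n) K) M} (hC : C.IsMinimal (irrelevantIdeal K n))
    {deg : ∀ i, C.ι i → ℤ} (hdeg : C.IsGraded ℳ deg) (i : ℕ) :
    totalBetti K n ℳ i = Nat.card (C.ι i) := by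
  classical
  have := Fintype.ofFinite (C.ι i)
  simp_rw [totalBetti, gradedBetti_eq P h hC hdeg i]
  rw [finsum_eq_sum_of_support_subset (s := Finset.univ.image (deg i))]
  · rw [Nat.card_eq_fintype_card, ← Finset.card_univ, Finset.card_eq_sum_card_image (deg i)]
    refine Finset.sum_congr rfl fun j _ => ?_
    rw [Nat.card_eq_fintype_card, Fintype.card_subtype]
  · intro j hj
    obtain ⟨⟨b, hb⟩⟩ := (Nat.card_ne_zero.1 hj).1
    simp only [Finset.coe_image, Finset.coe_univ, Set.image_univ]
    exact ⟨b, hb⟩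

theorem gradedBetti_ne_zero_iff {M : Type*} [AddCommGroup M] [Module (MvPolynomial (Fin n) K) M]
    {ℳ : ℤ → AddSubgroup M} (P : GradedProj K n ℳ)
    (h : Nonempty (MinimalGradedFreeResolution K n ℳ))
    {C : FreeResolution (MvPolynomial (Fin n) K) M} (hC : C.IsMinimal (irrelevantIdeal K n))
    {deg : ∀ i, C.ι i → ℤ} (hdeg : C.IsGraded ℳ deg) (i : ℕ) (j : ℤ) :
    gradedBetti K n ℳ i j ≠ 0 ↔ ∃ b, deg i b = j := by
  rw [gradedBetti_eq P h hC hdeg, Nat.card_ne_zero, nonempty_subtype]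
  exact and_iff_left inferInstance

theorem isGreatest_maxShift {M : Type*} [AddCommGroup M] [Module (MvPolynomial (Fin n) K) M]
    {ℳ : ℤ → AddSubgroup M} (P : GradedProj K n ℳ)
    (h : Nonempty (MinimalGradedFreeResolution K n ℳ))
    {C : FreeResolution (MvPolynomial (Fin n) K) M} (hC : C.IsMinimal (irrelevantIdeal K n))
    {deg : ∀ i, C.ι i → ℤ} (hdeg : C.IsGraded ℳ deg) {i : ℕ} (hi : Nonempty (C.ι i)) :
    IsGreatest (Set.range (deg i)) (maxShift K n ℳ i) := by
  have : {j : ℤ | gradedBetti K n ℳ i j ≠ 0} = Set.range (deg i) := by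
    ext j
    exact gradedBetti_ne_zero_iff P h hC hdeg i j
  rw [maxShift, this]
  have hfin := Set.finite_range (deg i)
  exact ⟨(Set.range_nonempty (deg i)).csSup_mem hfin, fun x hx => le_csSup hfin.bddAbove hx⟩

end Graded

/-! ### Resolutions of quotients by homogeneous ideals -/

section Quotient

variable {K : Type*} [Field K] {n : ℕ}

/-- The projections to the graded components of `S ⧸ I`. -/
noncomputable def quotientProj {I : Ideal (MvPolynomial (Fin n) K)}
    (hI : I.IsHomogeneous (homogeneousSubmodule (Fin n) K)) :
    GradedProj K n (quotientGrading I) where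
  π j := (Submodule.mapQ (I.restrictScalars K) (I.restrictScalars K) (polyComp K n j)
    (fun v hv => polyComp_mem hI j v hv)).toAddMonoidHom
  mem j v := by
    obtain ⟨v, rfl⟩ := Ideal.Quotient.mk_surjective v
    exact ⟨_, (selfProj K n).mem j v, rfl⟩
  same := by
    rintro j _ ⟨v, hv, rfl⟩
    exact congrArg (Ideal.Quotient.mk I) ((selfProj K n).same j v hv)
  ne := by
    rintro j k _ ⟨v, hv, rfl⟩ hk
    exact (congrArg (Ideal.Quotient.mk I) ((selfProj K n).ne j k v hv hk)).trans (map_zero _)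
  sum v := by
    obtain ⟨v, rfl⟩ := Ideal.Quotient.mk_surjective v
    obtain ⟨s, hs⟩ := (selfProj K n).sum v
    refine ⟨s, ?_⟩
    conv_rhs => rw [← hs, map_sum]
    rfl
  smul := by
    rintro i j g _ hg ⟨v, hv, rfl⟩
    exact ⟨g * v, (selfProj K n).smul i j g v hg hv, rfl⟩

/-- A proper homogeneous ideal is contained in `(x₁, …, xₙ)`. -/
theorem le_irrelevantIdeal {I : Ideal (MvPolynomial (Fin n) K)}
    (hI : I.IsHomogeneous (homogeneousSubmodule (Fin n) K)) (hne : I ≠ ⊤) :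
    I ≤ irrelevantIdeal K n := by
  intro g hg
  by_contra h
  refine hne (Ideal.eq_top_of_isUnit_mem I (polyComp_mem hI 0 g hg) ?_)
  have h1 : polyComp K n 0 g = C (constantCoeff g) := by
    simp [polyComp, homogeneousComponent_zero, constantCoeff_eq]
  rw [h1]
  exact (isUnit_iff_ne_zero.2 h).map C

/-- the index types of a resolution of `R ⧸ I` that continues a resolution of `I` with index
types `ι` -/
def OfIdealIndex (ι : ℕ → Type) : ℕ → Type
  | 0 => Unit
  | i + 1 => ι i

/-- The degrees of the basis vectors of `FreeResolution.ofIdeal`. -/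
def ofIdealDeg {ι : ℕ → Type} (deg : ∀ i, ι i → ℤ) : ∀ i, OfIdealIndex ι i → ℤ
  | 0 => fun _ => 0
  | i + 1 => deg i

namespace FreeResolution

/-- A resolution of the ideal `I` gives one of `S ⧸ I`, with `S` in homological degree `0`. -/
def ofIdeal {R : Type*} [CommRing R] {I : Ideal R} (C : FreeResolution R I) :
    FreeResolution R (R ⧸ I) where
  ι := OfIdealIndex C.ι
  finite
    | 0 => inferInstanceAs (Finite Unit)
    | i + 1 => C.finite i
  aug := I.mkQ ∘ₗ LinearMap.proj ()
  d
    | 0 => LinearMap.pi fun _ => I.subtype ∘ₗ C.aug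
    | i + 1 => C.d i
  aug_surjective v := by
    obtain ⟨v, rfl⟩ := I.mkQ_surjective v
    exact ⟨fun _ => v, rfl⟩
  exact_zero v := by
    change I.mkQ (v ()) = 0 ↔ _
    rw [Submodule.mkQ_apply, Submodule.Quotient.mk_eq_zero]
    constructor
    · intro h
      obtain ⟨w, hw⟩ := C.aug_surjective ⟨v (), h⟩
      exact ⟨w, funext fun _ => congrArg Subtype.val hw⟩
    · rintro ⟨w, rfl⟩
      exact (C.aug w).2
  exact_succ i := by
    cases i with
    | zero =>
      intro v
      refine Iff.trans ?_ (C.exact_zero v)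
      constructor
      · intro h
        exact Subtype.ext (congrFun h ())
      · intro h
        exact funext fun _ => congrArg Subtype.val h
    | succ i => exact C.exact_succ i

variable {I : Ideal (MvPolynomial (Fin n) K)} (C : FreeResolution (MvPolynomial (Fin n) K) I)

theorem ofIdeal_isMinimal (hI : I ≤ irrelevantIdeal K n) (hC : C.IsMinimal (irrelevantIdeal K n)) :
    C.ofIdeal.IsMinimal (irrelevantIdeal K n) := by
  intro i v a
  cases i with
  | zero => exact hI (C.aug v).2
  | succ i => exact hC i v a

theorem ofIdeal_isGraded {deg : ∀ i, C.ι i → ℤ} (hC : C.IsGraded (idealGrading I) deg) :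
    C.ofIdeal.IsGraded (quotientGrading I) (ofIdealDeg deg) where
  aug_mem j v hv := by
    have := hv ()
    exact ⟨v (), by rwa [show ofIdealDeg deg 0 () = 0 from rfl, sub_zero] at this, rfl⟩
  d_mem i := by
    cases i with
    | zero =>
      intro j v hv a
      change (C.aug v : MvPolynomial (Fin n) K) ∈ polyDeg K n (j - 0)
      rw [sub_zero]
      exact hC.aug_mem j v hv
    | succ i => exact hC.d_mem i

/-- The degrees of the basis vectors of the mapping cone of multiplication by a form of
degree `d`. -/
def coneDeg {ι : ℕ → Type} (deg : ∀ i, ι i → ℤ) (d : ℤ) : ∀ i, ConeIndex ι i → ℤ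
  | 0 => deg 0
  | i + 1 => Sum.elim (deg (i + 1)) fun b => deg i b + d

theorem cone_isGraded {M M' : Type*} [AddCommGroup M] [Module (MvPolynomial (Fin n) K) M]
    [AddCommGroup M'] [Module (MvPolynomial (Fin n) K) M'] {ℳ : ℤ → AddSubgroup M}
    {ℳ' : ℤ → AddSubgroup M'} (C : FreeResolution (MvPolynomial (Fin n) K) M)
    {deg : ∀ i, C.ι i → ℤ} (hC : C.IsGraded ℳ deg) {f : MvPolynomial (Fin n) K} {d : ℤ}
    (hfd : f ∈ polyDeg K n d) (hf : IsSMulRegular M f) (π : M →ₗ[MvPolynomial (Fin n) K] M')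
    (hπ : Function.Surjective π) (hker : ∀ x, π x = 0 ↔ ∃ y, f • y = x)
    (hπℳ : ∀ j, ∀ v ∈ ℳ j, π v ∈ ℳ' j) :
    (C.cone hf π hπ hker).IsGraded ℳ' (coneDeg deg d) where
  aug_mem j v hv := hπℳ j _ (hC.aug_mem j v hv)
  d_mem i := by
    have hsmul : ∀ (i : ℕ) (j : ℤ) (w : C.ι i → MvPolynomial (Fin n) K),
        IsHomogeneousVector (fun b => deg i b + d) j w → IsHomogeneousVector (deg i) j (f • w) := by
      intro i j w hw b
      have := mul_mem_polyDeg hfd (hw b)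
      rwa [show d + (j - (deg i b + d)) = j - deg i b by ring] at this
    have hsplit : ∀ (i : ℕ) (j : ℤ) (v : C.ι (i + 1) ⊕ C.ι i → MvPolynomial (Fin n) K),
        IsHomogeneousVector (Sum.elim (deg (i + 1)) fun b => deg i b + d) j v →
        IsHomogeneousVector (deg (i + 1)) j (fun b => v (Sum.inl b)) ∧
        IsHomogeneousVector (fun b => deg i b + d) j fun b => v (Sum.inr b) :=
      fun i j v hv => ⟨fun b => hv (Sum.inl b), fun b => hv (Sum.inr b)⟩
    cases i with
    | zero =>
      intro j v hv a
      obtain ⟨h1, h2⟩ := hsplit 0 j v hv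
      exact add_mem (hC.d_mem 0 j _ h1 a) (hsmul 0 j _ h2 a)
    | succ i =>
      intro j v hv a
      obtain ⟨h1, h2⟩ := hsplit (i + 1) j v hv
      cases a with
      | inl a => exact add_mem (hC.d_mem (i + 1) j _ h1 a) (hsmul (i + 1) j _ h2 a)
      | inr a =>
        have h3 : IsHomogeneousVector (deg (i + 1)) (j - d) fun b => v (Sum.inr b) := fun b => by
          have := h2 b
          rwa [show j - (deg (i + 1) b + d) = j - d - deg (i + 1) b by ring] at this
        have h4 := neg_mem (hC.d_mem i (j - d) _ h3 a)
        rwa [show j - d - deg i a = j - (deg i a + d) by ring] at h4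

theorem card_cone_succ {R : Type*} [CommRing R] {N N' : Type*} [AddCommGroup N] [Module R N]
    [AddCommGroup N'] [Module R N'] (C : FreeResolution R N) {f : R} (hf : IsSMulRegular N f)
    (π : N →ₗ[R] N') (hπ : Function.Surjective π) (hker : ∀ x, π x = 0 ↔ ∃ y, f • y = x) (i : ℕ) :
    Nat.card ((C.cone hf π hπ hker).ι (i + 1)) = Nat.card (C.ι (i + 1)) + Nat.card (C.ι i) :=
  Nat.card_sum (α := C.ι (i + 1)) (β := C.ι i)

end FreeResolution

/-- The minimal graded free resolution of `S ⧸ I` that starts with `S` in degree `0` and continues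
with a resolution of `I`. -/
theorem exists_resolution_quotient {I : Ideal (MvPolynomial (Fin n) K)}
    (hI : I.IsHomogeneous (homogeneousSubmodule (Fin n) K)) (hne : I ≠ ⊤) :
    ∃ (C : FreeResolution (MvPolynomial (Fin n) K) (MvPolynomial (Fin n) K ⧸ I))
      (deg : ∀ i, C.ι i → ℤ), C.IsMinimal (irrelevantIdeal K n) ∧
      C.IsGraded (quotientGrading I) deg ∧ Nat.card (C.ι 0) = 1 ∧ (∀ b, deg 0 b = 0) ∧
      ∀ i j, gradedBetti K n (idealGrading I) i j ≠ 0 ↔ ∃ b, deg (i + 1) b = j := by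
  obtain ⟨F⟩ := nonempty_resolution_ideal hI
  have P := (selfProj K n).restrict I (polyComp_mem hI)
  exact ⟨F.toFreeResolution.ofIdeal, ofIdealDeg F.deg,
    F.toFreeResolution.ofIdeal_isMinimal (le_irrelevantIdeal hI hne) F.isMinimal,
    F.toFreeResolution.ofIdeal_isGraded (F.isGraded P), Nat.card_unique (α := Unit), fun _ => rfl,
    gradedBetti_ne_zero_iff P ⟨F⟩ F.isMinimal (F.isGraded P)⟩

/-- The kernel of `R ⧸ I → R ⧸ (I, f)` consists of the multiples of `f`. -/
theorem factor_eq_zero_iff {R : Type*} [CommRing R] (I : Ideal R) (f : R) (x : R ⧸ I) :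
    (Submodule.factor (le_sup_left : I ≤ I ⊔ Ideal.span {f})) x = 0 ↔ ∃ y, f • y = x := by
  obtain ⟨x, rfl⟩ := I.mkQ_surjective x
  rw [← LinearMap.comp_apply, Submodule.factor_comp_mk, Submodule.mkQ_apply,
    Submodule.Quotient.mk_eq_zero, Submodule.mem_sup]
  constructor
  · rintro ⟨y, hy, z, hz, rfl⟩
    obtain ⟨z, rfl⟩ := Ideal.mem_span_singleton'.1 hz
    refine ⟨I.mkQ z, ?_⟩
    rw [← map_smul, ← sub_eq_zero, ← map_sub, Submodule.mkQ_apply, Submodule.Quotient.mk_eq_zero,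
      smul_eq_mul, mul_comm, sub_add_cancel_right]
    exact I.neg_mem hy
  · rintro ⟨y, hy⟩
    obtain ⟨y, rfl⟩ := I.mkQ_surjective y
    rw [← map_smul, ← sub_eq_zero, ← map_sub, Submodule.mkQ_apply,
      Submodule.Quotient.mk_eq_zero] at hy
    exact ⟨-(f • y - x), I.neg_mem hy, f • y,
      Ideal.mem_span_singleton'.2 ⟨y, mul_comm _ _⟩, by ring⟩

/-- The resolution of `S ⧸ (I, f)` obtained as the mapping cone of multiplication by the form `f`
on a resolution of `S ⧸ I`. -/
theorem exists_resolution_sup_span {I : Ideal (MvPolynomial (Fin n) K)}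
    {C : FreeResolution (MvPolynomial (Fin n) K) (MvPolynomial (Fin n) K ⧸ I)}
    {deg : ∀ i, C.ι i → ℤ} (hmin : C.IsMinimal (irrelevantIdeal K n))
    (hdeg : C.IsGraded (quotientGrading I) deg) {f : MvPolynomial (Fin n) K} {d : ℕ} (hd : 0 < d)
    (hf : f.IsHomogeneous d) (hreg : IsSMulRegular (MvPolynomial (Fin n) K ⧸ I) f) :
    ∃ (D : FreeResolution (MvPolynomial (Fin n) K) (MvPolynomial (Fin n) K ⧸ I ⊔ Ideal.span {f}))
      (deg' : ∀ i, D.ι i → ℤ), D.IsMinimal (irrelevantIdeal K n) ∧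
      D.IsGraded (quotientGrading (I ⊔ Ideal.span {f})) deg' ∧
      Nat.card (D.ι 0) = Nat.card (C.ι 0) ∧
      (∀ i, Nat.card (D.ι (i + 1)) = Nat.card (C.ι (i + 1)) + Nat.card (C.ι i)) ∧
      ∀ i j, (∃ b, deg' (i + 1) b = j) ↔ (∃ b, deg (i + 1) b = j) ∨ ∃ b, deg i b + d = j := by
  have hfd := mem_polyDeg_of_isHomogeneous hf
  have hf0 : f ∈ irrelevantIdeal K n :=
    constantCoeff_eq_zero_of_mem_polyDeg hfd (by exact_mod_cast hd.ne')
  refine ⟨C.cone hreg _ (Submodule.factor_surjective le_sup_left) (factor_eq_zero_iff I f),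
    FreeResolution.coneDeg deg d, C.cone_isMinimal _ _ _ _ hmin hf0,
    C.cone_isGraded hdeg hfd _ _ _ _ ?_, rfl, C.card_cone_succ _ _ _ _, fun i j => ?_⟩
  · rintro j _ ⟨g, hg, rfl⟩
    exact ⟨g, hg, rfl⟩
  · exact Sum.exists (α := C.ι (i + 1)) (β := C.ι i)
      (p := fun b => FreeResolution.coneDeg deg d (i + 1) b = j)

/-- The Koszul resolution: for linearly independent linear forms `l₁, …, l_r`, the `i`-th Betti
number of `S ⧸ (l₁, …, l_r)` is `r.choose i`. -/
theorem exists_resolution_linearForms (r : ℕ) (l : Fin r → MvPolynomial (Fin n) K)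
    (hl : ∀ k, (l k).IsHomogeneous 1) (hli : LinearIndependent K l) :
    ∃ (C : FreeResolution (MvPolynomial (Fin n) K)
        (MvPolynomial (Fin n) K ⧸ Ideal.span (Set.range l)))
      (deg : ∀ i, C.ι i → ℤ), C.IsMinimal (irrelevantIdeal K n) ∧
      C.IsGraded (quotientGrading (Ideal.span (Set.range l))) deg ∧
      ∀ i, Nat.card (C.ι i) = r.choose i := by
  induction r with
  | zero =>
    have hbot : Ideal.span (Set.range l) = ⊥ := by simp
    let C₀ : FreeResolution (MvPolynomial (Fin n) K) (Ideal.span (Set.range l)) :=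
      { ι := fun _ => Empty
        finite := fun _ => inferInstance
        aug := 0
        d := fun _ => 0
        aug_surjective := fun v => ⟨0, Subtype.ext (by
          have : (v : MvPolynomial (Fin n) K) ∈ (⊥ : Ideal _) := hbot ▸ v.2
          simpa using this.symm)⟩
        exact_zero := fun v => by simp [Subsingleton.elim v 0]
        exact_succ := fun i v => by simp [Subsingleton.elim v 0] }
    refine ⟨C₀.ofIdeal, ofIdealDeg fun _ b => b.elim, C₀.ofIdeal_isMinimal ?_ fun i v a => a.elim,
      C₀.ofIdeal_isGraded ⟨fun j v _ => zero_mem _, fun i j v _ a => a.elim⟩, fun i => ?_⟩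
    · rw [hbot]
      exact bot_le
    · cases i with
      | zero => exact Nat.card_unique (α := Unit)
      | succ i => exact Nat.card_of_isEmpty (α := Empty)
  | succ r ih =>
    let l' : Fin r → MvPolynomial (Fin n) K := fun k => l k.castSucc
    obtain ⟨C, deg, hmin, hdeg, hcard⟩ := ih l' (fun k => hl _)
      (hli.comp _ (Fin.castSucc_injective r))
    have hspan : Ideal.span (Set.range l') =
        Ideal.span (Submodule.span K (Set.range l') : Set (MvPolynomial (Fin n) K)) :=
      le_antisymm (Ideal.span_mono Submodule.subset_span) (Ideal.span_le.2 fun x hx =>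
        Submodule.span_subset_span K (MvPolynomial (Fin n) K) _ hx)
    have hreg : IsSMulRegular (MvPolynomial (Fin n) K ⧸ Ideal.span (Set.range l'))
        (l (Fin.last r)) := by
      rw [hspan]
      refine isSMulRegular_quotient_span _ (Submodule.span_le.2 ?_) (hl _) ?_
      · rintro _ ⟨k, rfl⟩
        exact hl _
      · have h1 := (linearIndependent_iff_notMem_span.1 hli) (Fin.last r)
        refine fun h => h1 (Submodule.span_mono ?_ h)
        rintro _ ⟨k, rfl⟩
        exact ⟨k.castSucc, by simp, rfl⟩
    have hsup : Ideal.span (Set.range l) =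
        Ideal.span (Set.range l') ⊔ Ideal.span {l (Fin.last r)} := by
      rw [← Ideal.span_union]
      congr 1
      ext x
      simp only [Set.mem_range, Fin.exists_fin_succ', Set.mem_union, Set.mem_singleton_iff, l']
      simp only [eq_comm]
    rw [hsup]
    obtain ⟨D, deg', hmin', hdeg', h0, hsucc, -⟩ :=
      exists_resolution_sup_span hmin hdeg one_pos (hl (Fin.last r)) hreg
    refine ⟨D, deg', hmin', hdeg', fun i => ?_⟩
    cases i with
    | zero => rw [h0, hcard, Nat.choose_zero_right, Nat.choose_zero_right]
    | succ i => rw [hsucc, hcard, hcard, Nat.choose_succ_succ, add_comm]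

end Quotient

/-! ### Shifts in resolutions of Cohen–Macaulay quotients -/

section Shifts

variable {K : Type*} [Field K] {n : ℕ}

/-- In a minimal resolution the degrees grow by at least one in each step. -/
theorem FreeResolution.IsGraded.le_deg {M : Type*} [AddCommGroup M]
    [Module (MvPolynomial (Fin n) K) M] {ℳ : ℤ → AddSubgroup M}
    {C : FreeResolution (MvPolynomial (Fin n) K) M} {deg : ∀ i, C.ι i → ℤ}
    (hdeg : C.IsGraded ℳ deg) (hmin : C.IsMinimal (irrelevantIdeal K n)) (h0 : ∀ b, deg 0 b = 0)
    (i : ℕ) (b : C.ι i) : (i : ℤ) ≤ deg i b := by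
  classical
  induction i with
  | zero => simp [h0]
  | succ i ih =>
    have hne : C.d i (Pi.single b 1) ≠ 0 := by
      intro h
      obtain ⟨w, hw⟩ := (C.exact_succ i _).1 h
      have := hmin (i + 1) w b
      rw [hw, Pi.single_eq_same] at this
      simp at this
    obtain ⟨a, ha⟩ := Function.ne_iff.1 hne
    have h1 := ih a
    by_contra h2
    refine ha (eq_zero_of_mem_polyDeg (hdeg.d_mem i _ _ (isHomogeneousVector_single _ b) a)
      (hmin i _ a) ?_)
    push_cast at h2
    omega

/-- For a Cohen–Macaulay quotient of projective dimension `p`, every basis vector `b` in homological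
degree `j < p` has smaller degree than some basis vector in degree `j + 1`. Otherwise the `b`-th
coordinate function would be a cocycle of `Hom(C, S)`, since the entries of a minimal graded
resolution in the row of `b` would have degree at most `0`; but it takes the value `1`. -/
theorem exists_deg_lt {I : Ideal (MvPolynomial (Fin n) K)} (hI : I ≤ irrelevantIdeal K n)
    (hCM : IsCohenMacaulay (MvPolynomial (Fin n) K ⧸ I))
    {C : FreeResolution (MvPolynomial (Fin n) K) (MvPolynomial (Fin n) K ⧸ I)}
    {deg : ∀ i, C.ι i → ℤ} (hmin : C.IsMinimal (irrelevantIdeal K n))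
    (hdeg : C.IsGraded (quotientGrading I) deg) {p : ℕ} (hp : Nonempty (C.ι p)) {j : ℕ}
    (hj : j < p) (b : C.ι j) : ∃ c, deg j b < deg (j + 1) c := by
  classical
  by_contra! h
  have := cocycle_apply_mem_irrelevantIdeal hI hCM C hmin hp hj (LinearMap.proj b)
    ((Pi.basisFun _ _).ext fun c => by
      rw [Pi.basisFun_apply]
      exact eq_zero_of_mem_polyDeg (hdeg.d_mem j _ _ (isHomogeneousVector_single _ c) b)
        (hmin j _ b) (by linarith [h c]))
    (Pi.single b 1)
  simp at this

theorem gradedBetti_idealGrading_ne_zero_iff {I : Ideal (MvPolynomial (Fin n) K)}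
    (hI : I.IsHomogeneous (homogeneousSubmodule (Fin n) K)) (hne : I ≠ ⊤) (i : ℕ) (j : ℤ) :
    gradedBetti K n (idealGrading I) i j ≠ 0 ↔
      gradedBetti K n (quotientGrading I) (i + 1) j ≠ 0 := by
  obtain ⟨C, deg, hmin, hdeg, -, -, h⟩ := exists_resolution_quotient hI hne
  rw [h, gradedBetti_ne_zero_iff (quotientProj hI) (nonempty_resolution_quotient hI) hmin hdeg]

theorem hasLinearResolution_one_iff {I : Ideal (MvPolynomial (Fin n) K)}
    (hI : I.IsHomogeneous (homogeneousSubmodule (Fin n) K)) (hne : I ≠ ⊤) :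
    HasLinearResolution 1 I ↔
      ∀ (i : ℕ) (j : ℤ), gradedBetti K n (quotientGrading I) (i + 1) j ≠ 0 → j = i + 1 := by
  constructor
  · intro h i j hj
    by_contra hne'
    refine (gradedBetti_idealGrading_ne_zero_iff hI hne i j).2 hj ?_
    have := h i (j - i) (by omega)
    rwa [add_sub_cancel] at this
  · intro h i j hj
    by_contra hne'
    have := h i _ ((gradedBetti_idealGrading_ne_zero_iff hI hne i _).1 hne')
    omega

/-- An ideal with a `1`-linear resolution is generated by linear forms. -/
theorem HasLinearResolution.exists_linearForms {I : Ideal (MvPolynomial (Fin n) K)}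
    (hI : I.IsHomogeneous (homogeneousSubmodule (Fin n) K)) (hlin : HasLinearResolution 1 I) :
    ∃ (r : ℕ) (l : Fin r → MvPolynomial (Fin n) K), (∀ k, (l k).IsHomogeneous 1) ∧
      LinearIndependent K l ∧ Ideal.span (Set.range l) = I := by
  classical
  obtain ⟨F⟩ := nonempty_resolution_ideal hI
  have P := (selfProj K n).restrict I (polyComp_mem hI)
  let W : Submodule K (MvPolynomial (Fin n) K) :=
    homogeneousSubmodule (Fin n) K 1 ⊓ I.restrictScalars K
  have hfin : FiniteDimensional K W := by
    have : FiniteDimensional K (homogeneousSubmodule (Fin n) K 1) := by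
      rw [homogeneousSubmodule_one_eq_span_X]
      exact FiniteDimensional.span_of_finite K (Set.finite_range _)
    exact Submodule.finiteDimensional_of_le (inf_le_left : W ≤ _)
  let B := Module.finBasis K W
  refine ⟨Module.finrank K W, fun k => B k, fun k => (B k).2.1,
    B.linearIndependent.map' W.subtype (by simp), le_antisymm ?_ fun g hg => ?_⟩
  · rw [Ideal.span_le]
    rintro _ ⟨k, rfl⟩
    exact (B k).2.2
  · have hW : ∀ v ∈ W, v ∈ Ideal.span (Set.range fun k => (B k : MvPolynomial (Fin n) K)) := by
      intro v hv
      have h1 := B.sum_repr ⟨v, hv⟩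
      have h2 := congrArg Subtype.val h1
      simp only [AddSubmonoidClass.coe_finsetSum, SetLike.val_smul] at h2
      rw [← h2]
      refine Ideal.sum_mem _ fun k _ => ?_
      rw [MvPolynomial.smul_eq_C_mul]
      exact Ideal.mul_mem_left _ _ (Ideal.subset_span ⟨k, rfl⟩)
    obtain ⟨v, hv⟩ := F.aug_surjective ⟨g, hg⟩
    have h1 := congrArg Subtype.val (apply_eq_sum F.aug v)
    rw [hv] at h1
    simp only [AddSubmonoidClass.coe_finsetSum, SetLike.val_smul] at h1
    rw [h1]
    refine Ideal.sum_mem _ fun b _ => Ideal.mul_mem_left _ _ (hW _ ⟨?_, (F.aug _).2⟩)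
    have hb : F.deg 0 b = 1 := by
      by_contra hb
      have h2 : gradedBetti K n (idealGrading I) 0 (F.deg 0 b) = 0 := by
        simpa using hlin 0 (F.deg 0 b) hb
      exact (gradedBetti_ne_zero_iff P ⟨F⟩ F.isMinimal (F.isGraded P) 0 (F.deg 0 b)).2 ⟨b, rfl⟩ h2
    have h3 : (F.aug (Pi.single b 1) : MvPolynomial (Fin n) K) ∈ polyDeg K n (F.deg 0 b) :=
      F.aug_homogeneous b
    intro m hm
    have h4 := h3 m hm
    rw [hb] at h4
    have h5 : m.degree = 1 := by exact_mod_cast h4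
    rw [← h5, Finsupp.degree_eq_weight_one]
    rfl

end Shifts

/-! ### The inequalities -/

section Numerics

open Finset

variable {p d : ℕ} {β β' : ℕ → ℕ} {M M' : ℕ → ℤ}

theorem natCast_le_of_strictMono (hM0 : M 0 = 0) (hM : ∀ i < p, M i < M (i + 1)) {i : ℕ}
    (hi : i ≤ p) : (i : ℤ) ≤ M i := by
  induction i with
  | zero => simp [hM0]
  | succ i ih =>
    have h1 := ih (by omega)
    have h2 := hM i (by omega)
    push_cast
    omega

theorem add_sub_le_of_strictMono (hM : ∀ i < p, M i < M (i + 1)) {i : ℕ}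
    (hi : i ≤ p) : M i + (p - i : ℕ) ≤ M p := by
  obtain ⟨k, rfl⟩ := Nat.exists_eq_add_of_le hi
  clear hi
  induction k with
  | zero => simp
  | succ k ih =>
    have h1 := ih fun j hj => hM j (by omega)
    have h2 := hM (i + k) (by omega)
    rw [Nat.add_sub_cancel_left] at h1 ⊢
    rw [← add_assoc]
    push_cast
    omega

theorem le_one_div_factorial_mul_iff {x q i : ℕ} {P : ℚ} :
    (x : ℚ) ≤ 1 / (((i - 1).factorial : ℚ) * ((q - i).factorial : ℚ)) * P ↔
      ((i - 1).factorial : ℚ) * ((q - i).factorial : ℚ) * x ≤ P := by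
  have h : (0 : ℚ) < ((i - 1).factorial : ℚ) * ((q - i).factorial : ℚ) := by positivity
  rw [one_div, ← div_eq_inv_mul, le_div_iff₀' h]

theorem eq_one_div_factorial_mul_iff {x q i : ℕ} {P : ℚ} :
    (x : ℚ) = 1 / (((i - 1).factorial : ℚ) * ((q - i).factorial : ℚ)) * P ↔
      ((i - 1).factorial : ℚ) * ((q - i).factorial : ℚ) * x = P := by
  have h : (0 : ℚ) < ((i - 1).factorial : ℚ) * ((q - i).factorial : ℚ) := by positivity
  rw [one_div, ← div_eq_inv_mul, eq_div_iff h.ne', mul_comm]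

theorem prod_erase_pos (hM0 : M 0 = 0) (hM : ∀ i < p, M i < M (i + 1)) (i : ℕ) :
    (0 : ℚ) < ∏ j ∈ (Icc 1 p).erase i, (M j : ℚ) := by
  refine prod_pos fun j hj => ?_
  have h1 := mem_Icc.1 (mem_of_mem_erase hj)
  have h2 := natCast_le_of_strictMono hM0 hM h1.2
  exact_mod_cast (by omega : 0 < M j)

theorem prod_Icc_id_eq_factorial (m : ℕ) : ∏ j ∈ Icc 1 m, (j : ℚ) = m.factorial := by
  induction m with
  | zero => simp
  | succ m ih =>
    rw [prod_Icc_succ_top (by omega), ih, Nat.factorial_succ]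
    push_cast
    ring

theorem factorial_mul_le_prod (hM0 : M 0 = 0) (hM : ∀ i < p, M i < M (i + 1)) (hβ0 : β 0 = 1)
    (hβ : ∀ i, 1 ≤ i → i ≤ p → ((i - 1).factorial : ℚ) * ((p - i).factorial : ℚ) * β i ≤
      ∏ j ∈ (Icc 1 p).erase i, (M j : ℚ)) {k : ℕ} (hk : k ≤ p) :
    (k.factorial : ℚ) * ((p - k).factorial : ℚ) * β k ≤ ∏ j ∈ Icc 1 p, (M j : ℚ) := by
  obtain _ | k := k
  · rw [hβ0, Nat.factorial_zero, Nat.sub_zero, ← prod_Icc_id_eq_factorial, Nat.cast_one,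
      one_mul, mul_one]
    refine prod_le_prod (fun j _ => by positivity) fun j hj => ?_
    exact_mod_cast natCast_le_of_strictMono hM0 hM (mem_Icc.1 hj).2
  · have h1 := hβ (k + 1) (by omega) hk
    rw [Nat.add_sub_cancel] at h1
    rw [← mul_prod_erase (Icc 1 p) (fun j => (M j : ℚ)) (mem_Icc.2 ⟨by omega, hk⟩),
      Nat.factorial_succ]
    have h2 : ((k + 1 : ℕ) : ℚ) ≤ M (k + 1) := by
      exact_mod_cast natCast_le_of_strictMono hM0 hM hk
    have h3 := prod_erase_pos hM0 hM (k + 1)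
    push_cast at h2 ⊢
    have h4 : (0 : ℚ) ≤ M (k + 1) := le_trans (by positivity) h2
    calc _ = (k + 1 : ℚ) * (k.factorial * (p - (k + 1)).factorial * β (k + 1)) := by ring
      _ ≤ (k + 1 : ℚ) * _ := by gcongr
      _ ≤ _ := by gcongr

/-- The bound for the Betti numbers `β'_{k+1} = β_{k+1} + β_k` of the mapping cone. With
`Q = ∏_{j ≠ k+1} M_j`, the two summands contribute at most `(p - k) Q` and `M_{k+1} Q`, and
`(p - k) + M_{k+1} ≤ M_p + 1` because the shifts increase strictly. -/
theorem cone_bound (hM0 : M 0 = 0) (hM : ∀ i < p, M i < M (i + 1)) (hβ0 : β 0 = 1)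
    (hβp : β (p + 1) = 0) (hd : 0 < d) (hβ' : ∀ i, β' (i + 1) = β (i + 1) + β i)
    (hM₁ : ∀ i, 1 ≤ i → i ≤ p → M i ≤ M' i) (hM₂ : ∀ i ≤ p, M i + d ≤ M' (i + 1))
    (hβ : ∀ i, 1 ≤ i → i ≤ p → ((i - 1).factorial : ℚ) * ((p - i).factorial : ℚ) * β i ≤
      ∏ j ∈ (Icc 1 p).erase i, (M j : ℚ)) {k : ℕ} (hk : k ≤ p) :
    (k.factorial : ℚ) * ((p - k).factorial : ℚ) * β' (k + 1) ≤
      ∏ j ∈ (Icc 1 (p + 1)).erase (k + 1), (M' j : ℚ) := by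
  have hA := factorial_mul_le_prod hM0 hM hβ0 hβ hk
  have hprod : ∀ s ⊆ Icc 1 p, ∏ j ∈ s, (M j : ℚ) ≤ ∏ j ∈ s, (M' j : ℚ) := by
    intro s hs
    refine prod_le_prod (fun j hj => ?_) fun j hj => ?_
    · have h1 := natCast_le_of_strictMono hM0 hM (mem_Icc.1 (hs hj)).2
      exact_mod_cast (by omega : 0 ≤ M j)
    · exact_mod_cast hM₁ j (mem_Icc.1 (hs hj)).1 (mem_Icc.1 (hs hj)).2
  have hIcc : Icc 1 (p + 1) = insert (p + 1) (Icc 1 p) := by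
    ext j
    simp only [mem_insert, mem_Icc]
    omega
  have hnot : p + 1 ∉ Icc 1 p := by simp
  rw [hβ', hIcc]
  obtain rfl | hkp := hk.eq_or_lt
  · rw [erase_insert hnot, hβp, zero_add]
    exact hA.trans (hprod _ subset_rfl)
  · rw [erase_insert_of_ne (by omega), prod_insert fun h => hnot (mem_of_mem_erase h)]
    have hQ := prod_erase_pos hM0 hM (k + 1)
    have hB := hβ (k + 1) (by omega) hkp
    rw [Nat.add_sub_cancel] at hB
    rw [← mul_prod_erase (Icc 1 p) (fun j => (M j : ℚ)) (mem_Icc.2 ⟨by omega, hkp⟩)] at hA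
    have hQ' := hprod _ (erase_subset (k + 1) (Icc 1 p))
    set Q := ∏ j ∈ (Icc 1 p).erase (k + 1), (M j : ℚ)
    set Q' := ∏ j ∈ (Icc 1 p).erase (k + 1), (M' j : ℚ)
    have hfac : ((p - k).factorial : ℚ) = (p - k : ℕ) * (p - (k + 1)).factorial := by
      rw [show p - k = p - (k + 1) + 1 by omega, Nat.factorial_succ]
      push_cast
      ring
    have hM' : ((p - k : ℕ) : ℚ) + M (k + 1) ≤ M' (p + 1) := by
      have h1 := add_sub_le_of_strictMono hM (i := k + 1) hkp
      have h2 := hM₂ p le_rfl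
      exact_mod_cast (by omega : ((p - k : ℕ) : ℤ) + M (k + 1) ≤ M' (p + 1))
    have hpos : (0 : ℚ) ≤ M' (p + 1) := by
      have h1 := natCast_le_of_strictMono hM0 hM (le_refl p)
      have h2 := hM₂ p le_rfl
      exact_mod_cast (by omega : 0 ≤ M' (p + 1))
    calc (k.factorial : ℚ) * (p - k).factorial * (β (k + 1) + β k : ℕ)
        = (p - k : ℕ) * (k.factorial * (p - (k + 1)).factorial * β (k + 1)) +
          k.factorial * (p - k).factorial * β k := by
          rw [hfac]
          push_cast
          ring
      _ ≤ (p - k : ℕ) * Q + M (k + 1) * Q := by gcongr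
      _ = ((p - k : ℕ) + M (k + 1)) * Q := by ring
      _ ≤ M' (p + 1) * Q := by gcongr
      _ ≤ M' (p + 1) * Q' := by gcongr

/-- Equality for the last Betti number of the cone forces `M_p = p` and `d = 1`: the estimate is
`p! β_p ≤ p ∏_{j < p} M_j ≤ ∏_{j ≤ p} M_j ≤ ∏_{j ≤ p} M'_j`. -/
theorem eq_of_cone_bound_eq (hp : 1 ≤ p) (hM0 : M 0 = 0) (hM : ∀ i < p, M i < M (i + 1))
    (hd : 0 < d) (hM₁ : ∀ i, 1 ≤ i → i ≤ p → M i ≤ M' i) (hM₂ : ∀ i ≤ p, M i + d ≤ M' (i + 1))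
    (hβ : ((p - 1).factorial : ℚ) * β p ≤ ∏ j ∈ (Icc 1 p).erase p, (M j : ℚ))
    (heq : (p.factorial : ℚ) * β p = ∏ j ∈ Icc 1 p, (M' j : ℚ)) :
    M p = p ∧ d = 1 := by
  obtain ⟨p, rfl⟩ : ∃ q, p = q + 1 := ⟨p - 1, by omega⟩
  rw [Nat.add_sub_cancel] at hβ
  have hmem : p + 1 ∈ Icc 1 (p + 1) := by simp
  have hpos : ∀ j ∈ Icc 1 (p + 1), (0 : ℚ) < M j := fun j hj => by
    have h1 := natCast_le_of_strictMono hM0 hM (mem_Icc.1 hj).2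
    have h2 := (mem_Icc.1 hj).1
    exact_mod_cast (by omega : 0 < M j)
  have hle : ∀ j ∈ Icc 1 (p + 1), (M j : ℚ) ≤ M' j := fun j hj => by
    exact_mod_cast hM₁ j (mem_Icc.1 hj).1 (mem_Icc.1 hj).2
  have hR := prod_erase_pos hM0 hM (p + 1)
  have h1 : ((p + 1).factorial : ℚ) * β (p + 1) ≤
      (p + 1 : ℚ) * ∏ j ∈ (Icc 1 (p + 1)).erase (p + 1), (M j : ℚ) := by
    rw [Nat.factorial_succ]
    push_cast
    rw [mul_assoc]
    gcongr
  have h2 := prod_le_prod (fun j hj => (hpos j hj).le) hle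
  have hMp : M (p + 1) = (p + 1 : ℕ) := by
    refine le_antisymm ?_ (natCast_le_of_strictMono hM0 hM le_rfl)
    by_contra! hlt
    have hlt' : ((p : ℚ) + 1) < M (p + 1) := by exact_mod_cast hlt
    rw [← mul_prod_erase _ (fun j => (M j : ℚ)) hmem] at h2
    have := mul_lt_mul_of_pos_right hlt' hR
    linarith
  refine ⟨hMp, ?_⟩
  by_contra hd1
  have h3 : M (p + 1) < M' (p + 1) := by
    have h4 := natCast_le_of_strictMono hM0 hM (i := p) (by omega)
    have h5 := hM₂ p (by omega)
    push_cast at hMp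
    omega
  have h6 := prod_lt_prod hpos hle ⟨p + 1, hmem, by exact_mod_cast h3⟩
  have h7 : ((p : ℚ) + 1) = M (p + 1) := by exact_mod_cast hMp.symm
  rw [← heq, ← mul_prod_erase _ (fun j => (M j : ℚ)) hmem, ← h7] at h6
  linarith
theorem factorial_mul_choose_eq_prod_erase {p k : ℕ} (hk : k ≤ p) :
    (k.factorial : ℚ) * ((p - k).factorial : ℚ) * (p + 1).choose (k + 1) =
      ∏ j ∈ (Icc 1 (p + 1)).erase (k + 1), (j : ℚ) := by
  have h1 : ((k : ℚ) + 1) ≠ 0 := by positivity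
  have h2 := mul_prod_erase (Icc 1 (p + 1)) (fun j => (j : ℚ))
    (a := k + 1) (mem_Icc.2 ⟨by omega, by omega⟩)
  have h3 : ∏ j ∈ Icc 1 (p + 1), (j : ℚ) = (p + 1).factorial :=
    prod_Icc_id_eq_factorial (p + 1)
  have h4 := Nat.choose_mul_factorial_mul_factorial (n := p + 1) (k := k + 1) (by omega)
  rw [show p + 1 - (k + 1) = p - k by omega, Nat.factorial_succ k] at h4
  have h5 : ((p + 1).choose (k + 1) : ℚ) * ((k + 1) * k.factorial) * (p - k).factorial =
      (p + 1).factorial := by exact_mod_cast h4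
  push_cast at h2
  refine mul_left_cancel₀ h1 ?_
  rw [h2, h3, ← h5]
  ring

end Numerics

end BettiBounds

/-! ### The bounds for `S ⧸ (I, f)` -/

open BettiBounds

theorem theorem2p3 {K : Type*} [Field K] {n : ℕ}
    (I : Ideal (MvPolynomial (Fin n) K))
    (hI : I.IsHomogeneous (MvPolynomial.homogeneousSubmodule (Fin n) K))
    (hCM : BettiBounds.IsCohenMacaulay (MvPolynomial (Fin n) K ⧸ I))
    (p : ℕ)
    (hp : CategoryTheory.projectiveDimension
      (ModuleCat.of (MvPolynomial (Fin n) K) (MvPolynomial (Fin n) K ⧸ I)) = p)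
    (f : MvPolynomial (Fin n) K) (d : ℕ) (hd : 0 < d) (hf : f.IsHomogeneous d)
    (hreg : IsSMulRegular (MvPolynomial (Fin n) K ⧸ I) f)
    (hbound : ∀ i, 1 ≤ i → i ≤ p →
      (BettiBounds.totalBetti K n (BettiBounds.quotientGrading I) i : ℚ) ≤
        BettiBounds.shiftBound K n (BettiBounds.quotientGrading I) p i) :
    (∀ i, 1 ≤ i → i ≤ p + 1 →
      (BettiBounds.totalBetti K n (BettiBounds.quotientGrading (I ⊔ Ideal.span {f})) i : ℚ) ≤
        BettiBounds.shiftBound K n (BettiBounds.quotientGrading (I ⊔ Ideal.span {f})) (p + 1) i) ∧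
    (1 ≤ p →
      ((∀ i, 1 ≤ i → i ≤ p + 1 →
        (BettiBounds.totalBetti K n (BettiBounds.quotientGrading (I ⊔ Ideal.span {f})) i : ℚ) =
          BettiBounds.shiftBound K n (BettiBounds.quotientGrading (I ⊔ Ideal.span {f})) (p + 1) i) ↔
        d = 1 ∧ BettiBounds.HasLinearResolution 1 I ∧
          BettiBounds.HasLinearResolution 1 (I ⊔ Ideal.span {f}))) := by
  have hne : I ≠ ⊤ := by
    rintro rfl
    have h1 : CategoryTheory.projectiveDimension (ModuleCat.of (MvPolynomial (Fin n) K)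
        (MvPolynomial (Fin n) K ⧸ (⊤ : Ideal (MvPolynomial (Fin n) K)))) = ⊥ :=
      (CategoryTheory.projectiveDimension_eq_bot_iff _).2 (ModuleCat.isZero_of_subsingleton _)
    rw [h1] at hp
    simp at hp
  have hIm := le_irrelevantIdeal hI hne
  have hfm : f ∈ irrelevantIdeal K n := constantCoeff_eq_zero_of_mem_polyDeg
    (mem_polyDeg_of_isHomogeneous hf) (by exact_mod_cast hd.ne')
  have hJ : (I ⊔ Ideal.span {f}).IsHomogeneous (MvPolynomial.homogeneousSubmodule (Fin n) K) :=
    hI.sup (Ideal.homogeneous_span _ _ (by rintro _ rfl; exact ⟨d, hf⟩))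
  have hJne : I ⊔ Ideal.span {f} ≠ ⊤ := by
    intro h
    have h1 : I ⊔ Ideal.span {f} ≤ irrelevantIdeal K n :=
      sup_le hIm ((Ideal.span_singleton_le_iff_mem _).2 hfm)
    rw [h, top_le_iff] at h1
    exact Ideal.IsPrime.ne_top inferInstance h1
  set J := I ⊔ Ideal.span {f}
  have P := quotientProj hI
  have hR := nonempty_resolution_quotient hI
  have P' := quotientProj hJ
  have hR' := nonempty_resolution_quotient hJ
  obtain ⟨C, deg, hmin, hdeg, hcard0, hdeg0, -⟩ := exists_resolution_quotient hI hne
  obtain ⟨D, deg', hmin', hdeg', -, hcard', hdegD⟩ :=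
    exists_resolution_sup_span hmin hdeg hd hf hreg
  have hC : ∀ i, Nonempty (C.ι i) ↔ i ≤ p :=
    C.nonempty_iff_le_projectiveDimension (Ideal.IsPrime.ne_top inferInstance) hmin hp
  have hCp : Nat.card (C.ι (p + 1)) = 0 := by
    have : IsEmpty (C.ι (p + 1)) := by
      rw [← not_nonempty_iff, hC]
      omega
    exact Nat.card_of_isEmpty
  have hCpos : ∀ i ≤ p, 0 < Nat.card (C.ι i) := fun i hi =>
    have := (hC i).2 hi
    Nat.card_pos
  have hD : ∀ i, 1 ≤ i → i ≤ p + 1 → Nonempty (D.ι i) := by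
    intro i h1 hi
    obtain ⟨i, rfl⟩ : ∃ k, i = k + 1 := ⟨i - 1, by omega⟩
    refine (Nat.card_pos_iff.1 ?_).1
    rw [hcard']
    have := hCpos i (by omega)
    omega
  have hDp : Nat.card (D.ι (p + 2)) = 0 := by
    have : IsEmpty (C.ι (p + 2)) := by
      rw [← not_nonempty_iff, hC]
      omega
    rw [hcard', hCp, Nat.card_of_isEmpty]
  set M : ℕ → ℤ := maxShift K n (quotientGrading I)
  set M' : ℕ → ℤ := maxShift K n (quotientGrading J)
  have hMg : ∀ i ≤ p, IsGreatest (Set.range (deg i)) (M i) := fun i hi =>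
    isGreatest_maxShift P hR hmin hdeg ((hC i).2 hi)
  have hMg' : ∀ i, 1 ≤ i → i ≤ p + 1 → IsGreatest (Set.range (deg' i)) (M' i) := fun i h1 hi =>
    isGreatest_maxShift P' hR' hmin' hdeg' (hD i h1 hi)
  have hM0 : M 0 = 0 := by
    obtain ⟨b, hb⟩ := (hMg 0 (by omega)).1
    rw [← hb, hdeg0]
  have hM : ∀ i < p, M i < M (i + 1) := by
    intro i hi
    obtain ⟨b, hb⟩ := (hMg i hi.le).1
    obtain ⟨c, hc⟩ := exists_deg_lt hIm hCM hmin hdeg ((hC p).2 le_rfl) hi b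
    rw [← hb]
    exact hc.trans_le ((hMg (i + 1) hi).2 ⟨c, rfl⟩)
  have hM₁ : ∀ i, 1 ≤ i → i ≤ p → M i ≤ M' i := by
    intro i h1 hi
    obtain ⟨i, rfl⟩ : ∃ k, i = k + 1 := ⟨i - 1, by omega⟩
    obtain ⟨b, hb⟩ := (hMg (i + 1) hi).1
    exact (hMg' (i + 1) h1 (by omega)).2 ((hdegD i _).2 (Or.inl ⟨b, hb⟩))
  have hM₂ : ∀ i ≤ p, M i + d ≤ M' (i + 1) := by
    intro i hi
    obtain ⟨b, hb⟩ := (hMg i hi).1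
    exact (hMg' (i + 1) (by omega) (by omega)).2 ((hdegD i _).2 (Or.inr ⟨b, by rw [hb]⟩))
  have hβ : ∀ i, 1 ≤ i → i ≤ p →
      ((i - 1).factorial : ℚ) * ((p - i).factorial : ℚ) * Nat.card (C.ι i) ≤
        ∏ j ∈ (Finset.Icc 1 p).erase i, (M j : ℚ) := by
    intro i h1 hi
    have := hbound i h1 hi
    rw [totalBetti_eq P hR hmin hdeg] at this
    exact le_one_div_factorial_mul_iff.1 this
  have hall : ∀ {Q : ℕ → Prop}, (∀ i, 1 ≤ i → i ≤ p + 1 → Q i) ↔ ∀ k ≤ p, Q (k + 1) :=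
    ⟨fun h k hk => h (k + 1) (by omega) (by omega), fun h i h1 hi => by
      obtain ⟨k, rfl⟩ : ∃ k, i = k + 1 := ⟨i - 1, by omega⟩
      exact h k (by omega)⟩
  simp only [totalBetti_eq P' hR' hmin' hdeg', shiftBound, le_one_div_factorial_mul_iff,
    eq_one_div_factorial_mul_iff]
  rw [hall, hall]
  simp only [Nat.add_sub_cancel, Nat.add_sub_add_right]
  refine ⟨fun k hk => cone_bound (β := fun i => Nat.card (C.ι i))
    (β' := fun i => Nat.card (D.ι i)) hM0 hM hcard0 hCp hd hcard' hM₁ hM₂ hβ hk, fun hp1 => ?_⟩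
  rw [hasLinearResolution_one_iff hI hne, hasLinearResolution_one_iff hJ hJne]
  simp only [gradedBetti_ne_zero_iff P hR hmin hdeg, gradedBetti_ne_zero_iff P' hR' hmin' hdeg']
  constructor
  · intro heq
    -- Equality for `i = p + 1` already forces `M_p = p` and `d = 1`. Then `i ≤ deg i b ≤ M_i` and
    -- `M_i + (p - i) ≤ M_p = p` show that all degrees in homological degree `i` are `i`.
    have h1 := heq p le_rfl
    have hIcc : (Finset.Icc 1 (p + 1)).erase (p + 1) = Finset.Icc 1 p := by
      ext j
      simp only [Finset.mem_erase, Finset.mem_Icc]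
      omega
    rw [hcard', hCp, hIcc, Nat.sub_self, Nat.factorial_zero, Nat.cast_one, mul_one, zero_add] at h1
    have h2 := hβ p hp1 le_rfl
    rw [Nat.sub_self, Nat.factorial_zero, Nat.cast_one, mul_one] at h2
    obtain ⟨hMp, rfl⟩ := eq_of_cone_bound_eq (β := fun i => Nat.card (C.ι i)) hp1 hM0 hM hd
      hM₁ hM₂ h2 h1
    have hlin : ∀ i b, deg i b = i := by
      intro i b
      have hi := (hC i).1 ⟨b⟩
      have h3 := hdeg.le_deg hmin hdeg0 i b
      have h4 := (hMg i hi).2 ⟨b, rfl⟩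
      have h5 := add_sub_le_of_strictMono hM hi
      omega
    refine ⟨rfl, ?_, ?_⟩
    · rintro i j ⟨b, rfl⟩
      rw [hlin]
      push_cast
      rfl
    · intro i j hj
      obtain ⟨b, rfl⟩ | ⟨b, rfl⟩ := (hdegD i j).1 hj
      · rw [hlin]
        push_cast
        rfl
      · rw [hlin]
        push_cast
        rfl
  · rintro ⟨-, -, hlin⟩ k hk
    -- The Koszul resolution of `S ⧸ J` on `r` linear forms has length `r`, which is `p + 1` because
    -- `D` has length `p + 1`.
    obtain ⟨r, l, hl, hli, hspan⟩ := HasLinearResolution.exists_linearForms hJ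
      ((hasLinearResolution_one_iff hJ hJne).2 fun i j hj => hlin i j
        ((gradedBetti_ne_zero_iff P' hR' hmin' hdeg' _ _).1 hj))
    have hE := exists_resolution_linearForms r l hl hli
    rw [hspan] at hE
    obtain ⟨E, degE, hminE, hdegE, hcardE⟩ := hE
    have hDE : ∀ i, Nat.card (D.ι i) = r.choose i := by
      intro i
      rw [← hcardE, ← totalBetti_eq P' hR' hmin' hdeg', totalBetti_eq P' hR' hminE hdegE]
    have hr : r = p + 1 := by
      have h1 := Nat.card_pos_iff.2 ⟨hD (p + 1) (by omega) le_rfl, inferInstance⟩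
      rw [hDE, Nat.pos_iff_ne_zero, Ne, Nat.choose_eq_zero_iff] at h1
      rw [hDE, Nat.choose_eq_zero_iff] at hDp
      omega
    have hM'j : ∀ j ∈ (Finset.Icc 1 (p + 1)).erase (k + 1), (M' j : ℚ) = j := by
      intro j hj
      obtain ⟨h1, h2⟩ := Finset.mem_Icc.1 (Finset.mem_of_mem_erase hj)
      obtain ⟨j, rfl⟩ : ∃ m, j = m + 1 := ⟨j - 1, by omega⟩
      rw [hlin j _ (hMg' (j + 1) h1 h2).1]
      push_cast
      rfl
    rw [hDE, hr, Finset.prod_congr rfl hM'j]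
    exact factorial_mul_choose_eq_prod_erase hk
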